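/- Let $M\in\mathbb{R}^{n_1\times n_2}$ be a fixed matrix of arbitrary rank, let $n=\max(n_1,n_2)$, and let $\sigma_1(M)\ge\sigma_2(M)\ge\dots$ be its singular values, continued by zeros. For matrices $A_1,\dots,A_m\in\mathbb{R}^{n_1\times n_2}$ let $\mathcal{A}(X)=(\operatorname{trace}(A_i^{*}X))_{1\le i\le m}$, with adjoint $\mathcal{A}^*(q)=\sum_{i=1}^m q_iA_i$. Suppose that $\mathcal{A}$ is drawn from the Gaussian measurement ensemble, i.e. the entries of $A_1,\dots,A_m$ are i.i.d. $\mathcal{N}(0,1/m)$, and that one observes $y=\mathcal{A}(M)+z$, where the noise $z\in\mathbb{R}^m$ has i.i.d. $\mathcal{N}(0,\sigma^2)$ entries, $\sigma\ge0$, and is independent of $\mathcal{A}$. Write $\|\cdot\|_F$, $\|\cdot\|$, $\|\cdot\|_*$ for the Frobenius, operator and nuclear norms. There are numerical constants $c_0,c_1,C,D,d>0$, independent of $n_1,n_2,m,\bar r,M,\sigma$, such that the following holds whenever $$ n\le c_1 m,\qquad m\le \frac{c_0\,n^2}{\log(m/n)},\qquad \bar r\in\mathbb{Z},\quad 0\le\bar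 r\le \frac{c_1m}{n}.$$ (i) With probability greater than $1-De^{-dn}$, every solution $\hat M$ of the matrix Dantzig selector $$\text{minimize } \|X\|_*\quad\text{subject to}\quad \|\mathcal{A}^*(y-\mathcal{A}(X))\|\le\lambda,\qquad \lambda=16\sqrt n\,\sigma,$$ satisfies $$\|\hat M-M\|_F^2\le C\Big(\sum_{i=1}^{\bar r}\min(\sigma_i^2(M),n\sigma^2)+\sum_{i=\bar r+1}^{n}\sigma_i^2(M)\Big).$$ (ii) If $\sigma>0$, then with probability greater than $1-De^{-dn}$ the same bound holds for every solution $\hat M$ of the matrix Lasso $$\text{minimize } \tfrac12\|\mathcal{A}(X)-y\|_{\ell_2}^2+\mu\|X\|_*,\qquad \mu=32\sqrt n\,\sigma.$$ In particular (i) covers the noiseless case $\sigma=0$, where the bound reads $\|\hat M-M\|_F^2\le C\sum_{i=\bar r+1}^{n}\sigma_i^2(M)$. -/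

import Mathlib

open MeasureTheory ProbabilityTheory
open scoped NNReal

noncomputable section

namespace MatrixRecovery

variable {n₁ n₂ m : ℕ}

/-- The singular values of a real matrix in decreasing order, counted with multiplicity and
continued by zeros. They are indexed from `0`: `singularValue X i` is `σ_{i+1}(X)`. -/
def singularValue (X : Matrix (Fin n₁) (Fin n₂) ℝ) (i : ℕ) : ℝ :=
  (Matrix.toEuclideanLin X).singularValues i

/-- The nuclear norm: the sum of the singular values. An `n₁ × n₂` matrix has at most
`max n₁ n₂` nonzero singular values. -/
def nuclearNorm (X : Matrix (Fin n₁) (Fin n₂) ℝ) : ℝ :=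
  ∑ i ∈ Finset.range (max n₁ n₂), singularValue X i

/-- The operator norm of a matrix as a map between Euclidean spaces. -/
def opNorm (X : Matrix (Fin n₁) (Fin n₂) ℝ) : ℝ :=
  ‖(Matrix.toEuclideanLin X).toContinuousLinearMap‖

/-- The Frobenius norm. -/
def frobeniusNorm (X : Matrix (Fin n₁) (Fin n₂) ℝ) : ℝ :=
  √(∑ j, ∑ k, X j k ^ 2)

/-- The measurement map `𝒜` with rows `A i`: `𝒜(X)_i = ⟨A i, X⟩ = trace ((A i)ᵀ X)`. -/
def measurementMap (A : Fin m → Matrix (Fin n₁) (Fin n₂) ℝ) (X : Matrix (Fin n₁) (Fin n₂) ℝ) :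
    Fin m → ℝ :=
  fun i => ((A i).transpose * X).trace

/-- The adjoint `𝒜^*(q) = ∑ i, q i • A i` of the measurement map. -/
def measurementAdjoint (A : Fin m → Matrix (Fin n₁) (Fin n₂) ℝ) (q : Fin m → ℝ) :
    Matrix (Fin n₁) (Fin n₂) ℝ :=
  ∑ i, q i • A i

/-- The constraint of the matrix Dantzig selector: `‖𝒜^*(y - 𝒜(X))‖ ≤ lam`. -/
def DantzigFeasible (A : Fin m → Matrix (Fin n₁) (Fin n₂) ℝ) (y : Fin m → ℝ) (lam : ℝ)
    (X : Matrix (Fin n₁) (Fin n₂) ℝ) : Prop :=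
  opNorm (measurementAdjoint A (y - measurementMap A X)) ≤ lam

/-- `X` solves the matrix Dantzig selector: it has minimal nuclear norm among the feasible
matrices. -/
def IsDantzigSolution (A : Fin m → Matrix (Fin n₁) (Fin n₂) ℝ) (y : Fin m → ℝ) (lam : ℝ)
    (X : Matrix (Fin n₁) (Fin n₂) ℝ) : Prop :=
  DantzigFeasible A y lam X ∧
    ∀ X' : Matrix (Fin n₁) (Fin n₂) ℝ, DantzigFeasible A y lam X' → nuclearNorm X ≤ nuclearNorm X'

/-- The matrix Lasso objective `(1/2) ‖𝒜(X) - y‖₂² + μ ‖X‖_*`. -/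
def lassoObjective (A : Fin m → Matrix (Fin n₁) (Fin n₂) ℝ) (y : Fin m → ℝ) (mu : ℝ)
    (X : Matrix (Fin n₁) (Fin n₂) ℝ) : ℝ :=
  1 / 2 * ∑ i, (measurementMap A X i - y i) ^ 2 + mu * nuclearNorm X

/-- `X` solves the matrix Lasso. -/
def IsLassoSolution (A : Fin m → Matrix (Fin n₁) (Fin n₂) ℝ) (y : Fin m → ℝ) (mu : ℝ)
    (X : Matrix (Fin n₁) (Fin n₂) ℝ) : Prop :=
  ∀ X' : Matrix (Fin n₁) (Fin n₂) ℝ, lassoObjective A y mu X ≤ lassoObjective A y mu X'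

/-- The Gaussian measurement ensemble: all entries of all rows `A i` are independent with law
`N(0, 1/m)`. -/
structure IsGaussianEnsemble {Ω : Type*} [MeasurableSpace Ω] (P : Measure Ω)
    (A : Ω → Fin m → Matrix (Fin n₁) (Fin n₂) ℝ) : Prop where
  law : ∀ i j k, HasLaw (fun ω => A ω i j k) (gaussianReal 0 (m : ℝ≥0)⁻¹) P
  indep : iIndepFun (fun (p : Fin m × Fin n₁ × Fin n₂) (ω : Ω) => A ω p.1 p.2.1 p.2.2) P

/-- Gaussian noise of standard deviation `σ`: the coordinates are independent with law
`N(0, σ²)` (a point mass at `0` if `σ = 0`). -/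
structure IsGaussianNoise {Ω : Type*} [MeasurableSpace Ω] (P : Measure Ω)
    (σ : ℝ≥0) (z : Ω → Fin m → ℝ) : Prop where
  law : ∀ i, HasLaw (fun ω => z ω i) (gaussianReal 0 (σ ^ 2)) P
  indep : iIndepFun (fun (i : Fin m) (ω : Ω) => z ω i) P

/-- The right-hand side of the error bound without its constant, with `n = max n₁ n₂`:
`∑_{i ≤ r} min(σ_i²(M), n σ²) + ∑_{r < i ≤ n} σ_i²(M)`. -/
def instanceError (M : Matrix (Fin n₁) (Fin n₂) ℝ) (σ : ℝ≥0) (r : ℕ) : ℝ :=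
  ∑ i ∈ Finset.range r, min (singularValue M i ^ 2) ((max n₁ n₂ : ℕ) * (σ : ℝ) ^ 2)
    + ∑ i ∈ Finset.Ico r (max n₁ n₂), singularValue M i ^ 2

end MatrixRecovery

end

/-! Split `M = M₀ + T`, where `M₀` collects those of the first `r₀ ~ m/n` singular components whose
size exceeds the noise level `√n σ`. Then `I.card * n * σ² + ‖T‖_F² ≤ instanceError M σ r`
(`exists_split`), so it is enough to recover `M₀` up to this error. The difficulty is that `T` need
not have low rank, so no restricted isometry property controls `𝒜(T)` directly.

If `‖T‖ ≤ √n σ` and `‖T‖_F² ≤ mσ²/5`, then `𝒜(T) + z` behaves like noise: `𝒜^*(𝒜(T) + z)` is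
concentrated around `T` in operator norm, hence is at most `16 √n σ` (`prob_opNorm_noise_gt_le`).
The signal is then `M₀` alone.

Otherwise `mσ²` is at most a constant times the error: either `‖T‖_F²` is already that large, or all
`r₀` slots are filled and `m σ² ≲ r₀ n σ²`. A quotient property of `𝒜` replaces `T` by `S` with the
same measurements and with `‖S‖_* ≲ √(m/n) ‖T‖_F` (`HasSmallPreimage`). The signal is then `M₀ + S`,
with noise `z`.

In both cases the deterministic part is the same. Near-additivity of the nuclear norm at a low-rank
matrix (`nuclearNorm_add_nuclearNorm_le`) puts `E = Mhat - M₀` into a cone and bounds `‖𝒜(E - S)‖`.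
A restricted isometry is bounded below on such a cone (`IsRestrictedIsometry.lower_bound`), and
`frobeniusNorm_sq_le_of_cone_bounds` combines the two. Since `T` depends on `M` and `σ` only, the
random events concern fixed matrices; nets are needed just for low-rank products, for the adjoint
and for the operator norm. -/

namespace MatrixRecovery

/-! ### Nets of unit balls and bilinear maps -/

section Nets

open Metric Module Set

variable {E F G : Type*} [NormedAddCommGroup E] [NormedSpace ℝ E] [FiniteDimensional ℝ E]
  [NormedAddCommGroup F] [NormedSpace ℝ F] [FiniteDimensional ℝ F]
  [NormedAddCommGroup G] [NormedSpace ℝ G]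

-- Volume comparison: the balls of radius `1/32` around the points are disjoint and lie in the ball
-- of radius `33/32`.
open scoped Function ENNReal in
theorem card_le_of_sixteenth_separated (s : Finset E) (hs : ∀ c ∈ s, ‖c‖ ≤ 1)
    (h : ∀ c ∈ s, ∀ d ∈ s, c ≠ d → 1 / 16 ≤ ‖c - d‖) : s.card ≤ 33 ^ finrank ℝ E := by
  borelize E
  let μ : Measure E := Measure.addHaar
  have D : Set.Pairwise (s : Set E) (Disjoint on fun c => ball (c : E) (1 / 32)) := by
    rintro c hc d hd hcd
    apply ball_disjoint_ball
    rw [dist_eq_norm]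
    have := h c hc d hd hcd
    linarith
  have hsub : (⋃ c ∈ s, ball (c : E) (1 / 32)) ⊆ ball (0 : E) (33 / 32) := by
    refine iUnion₂_subset fun x hx => ball_subset_ball' ?_
    rw [dist_zero_right]
    linarith [hs x hx]
  have I : (s.card : ℝ≥0∞) * ENNReal.ofReal ((1 / 32) ^ finrank ℝ E) * μ (ball 0 1) ≤
      ENNReal.ofReal ((33 / 32) ^ finrank ℝ E) * μ (ball 0 1) :=
    calc
      _ = μ (⋃ c ∈ s, ball (c : E) (1 / 32)) := by
        rw [measure_biUnion_finset D fun c _ => measurableSet_ball]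
        simp only [μ.addHaar_ball_of_pos _ (by norm_num : (0 : ℝ) < 1 / 32)]
        simp only [Finset.sum_const, nsmul_eq_mul, mul_assoc]
      _ ≤ μ (ball (0 : E) (33 / 32)) := measure_mono hsub
      _ = _ := by simp only [μ.addHaar_ball_of_pos _ (by norm_num : (0 : ℝ) < 33 / 32)]
  have J := (ENNReal.mul_le_mul_iff_left (measure_ball_pos μ _ zero_lt_one).ne'
    measure_ball_lt_top.ne).1 I
  have K : (s.card : ℝ) ≤ (33 : ℝ) ^ finrank ℝ E := by
    have := ENNReal.toReal_le_of_le_ofReal (by positivity) J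
    simpa [div_eq_mul_inv, mul_pow] using this
  exact mod_cast K

variable (E) in
/-- The unit ball of a `d`-dimensional normed space has a `1/16`-net of at most `33 ^ d` points. -/
theorem exists_net : ∃ s : Finset E, (∀ p ∈ s, ‖p‖ ≤ 1) ∧
    (∀ x : E, ‖x‖ ≤ 1 → ∃ p ∈ s, ‖x - p‖ ≤ 1 / 16) ∧ s.card ≤ 33 ^ finrank ℝ E := by
  classical
  -- A separated set of maximal cardinality is a net; the maximum exists because the cardinalities
  -- are bounded.
  let S : Set ℕ := {k | ∃ s : Finset E, (∀ p ∈ s, ‖p‖ ≤ 1) ∧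
    (∀ c ∈ s, ∀ d ∈ s, c ≠ d → 1 / 16 ≤ ‖c - d‖) ∧ s.card = k}
  have hne : S.Nonempty := ⟨0, ∅, by simp⟩
  have hbdd : BddAbove S := by
    refine ⟨33 ^ finrank ℝ E, ?_⟩
    rintro _ ⟨s, h1, h2, rfl⟩
    exact card_le_of_sixteenth_separated s h1 h2
  obtain ⟨s, h1, h2, h3⟩ := Nat.sSup_mem hne hbdd
  refine ⟨s, h1, fun x hx => ?_, card_le_of_sixteenth_separated s h1 h2⟩
  by_contra! hcon
  have hxs : x ∉ s := fun hxs => by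
    have := hcon x hxs
    norm_num at this
  have : (insert x s).card ∈ S := by
    refine ⟨insert x s, ?_, ?_, rfl⟩
    · intro p hp
      rcases Finset.mem_insert.1 hp with rfl | hp
      · exact hx
      · exact h1 p hp
    · intro c hc d hd hcd
      rcases Finset.mem_insert.1 hc with rfl | hc' <;> rcases Finset.mem_insert.1 hd with rfl | hd'
      · exact absurd rfl hcd
      · exact (hcon d hd').le
      · rw [norm_sub_rev]; exact (hcon c hc').le
      · exact h2 c hc' d hd' hcd
  have hle := le_csSup hbdd this
  rw [Finset.card_insert_of_notMem hxs] at hle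
  omega

omit [FiniteDimensional ℝ E] [FiniteDimensional ℝ F] in
/-- A bilinear map that is bounded by `κ` on nets of the unit balls is bounded by `8κ/7`. -/
theorem norm_bilinear_le_of_net {s : Finset E} {t : Finset F} (B : E →L[ℝ] F →L[ℝ] G)
    (hs : ∀ p ∈ s, ‖p‖ ≤ 1) (hs' : ∀ x : E, ‖x‖ ≤ 1 → ∃ p ∈ s, ‖x - p‖ ≤ 1 / 16)
    (ht' : ∀ x : F, ‖x‖ ≤ 1 → ∃ p ∈ t, ‖x - p‖ ≤ 1 / 16)
    {κ : ℝ} (hκ : ∀ p ∈ s, ∀ q ∈ t, ‖B p q‖ ≤ κ) (x : E) (y : F) :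
    ‖B x y‖ ≤ 8 / 7 * κ * ‖x‖ * ‖y‖ := by
  suffices h : ‖B‖ ≤ 8 / 7 * κ from
    (B.le_opNorm₂ x y).trans (by gcongr)
  -- Rounding each argument to its net costs `‖B‖ / 16`. Absorbing the total `‖B‖ / 8` on the left
  -- gives the factor `8/7`.
  have key : ‖B‖ ≤ κ + 1 / 8 * ‖B‖ := by
    obtain ⟨p₀, hp₀, -⟩ := hs' 0 (by simp)
    obtain ⟨q₀, hq₀, -⟩ := ht' 0 (by simp)
    have hκ0 : 0 ≤ κ := (norm_nonneg _).trans (hκ p₀ hp₀ q₀ hq₀)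
    have hC : 0 ≤ κ + 1 / 8 * ‖B‖ := by positivity
    refine ContinuousLinearMap.opNorm_le_of_unit_norm hC fun x hx => ?_
    refine ContinuousLinearMap.opNorm_le_of_unit_norm hC fun y hy => ?_
    obtain ⟨p, hp, hxp⟩ := hs' x hx.le
    obtain ⟨q, hq, hyq⟩ := ht' y hy.le
    have e : B x y = B p q + B (x - p) y + B p (y - q) := by simp; abel
    have h1 : ‖B (x - p) y‖ ≤ ‖B‖ * (1 / 16) * 1 :=
      (B.le_opNorm₂ _ _).trans (by gcongr; exact hy.le)
    have h2 : ‖B p (y - q)‖ ≤ ‖B‖ * 1 * (1 / 16) :=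
      (B.le_opNorm₂ _ _).trans (by gcongr; exact hs p hp)
    have h3 := hκ p hp q hq
    rw [e]
    calc _ ≤ ‖B p q‖ + ‖B (x - p) y‖ + ‖B p (y - q)‖ := norm_add₃_le
      _ ≤ _ := by linarith
  linarith

omit [FiniteDimensional ℝ E] [FiniteDimensional ℝ F] in
/-- Two-sided comparison of a bilinear map `B` with a contractive bilinear map `B₀`, from the
comparison on nets of the unit balls. -/
theorem norm_bilinear_ge_of_net {G' : Type*} [NormedAddCommGroup G'] [NormedSpace ℝ G']
    {s : Finset E} {t : Finset F} (B : E →L[ℝ] F →L[ℝ] G) (B₀ : E →L[ℝ] F →L[ℝ] G')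
    (hs : ∀ p ∈ s, ‖p‖ ≤ 1) (hs' : ∀ x : E, ‖x‖ ≤ 1 → ∃ p ∈ s, ‖x - p‖ ≤ 1 / 16)
    (ht : ∀ p ∈ t, ‖p‖ ≤ 1) (ht' : ∀ x : F, ‖x‖ ≤ 1 → ∃ p ∈ t, ‖x - p‖ ≤ 1 / 16)
    (hB₀ : ∀ x y, ‖B₀ x y‖ ≤ ‖x‖ * ‖y‖) {β : ℝ}
    (hβ : ∀ p ∈ s, ∀ q ∈ t, 7 / 10 * β * ‖B₀ p q‖ ≤ ‖B p q‖ ∧ ‖B p q‖ ≤ 2 * β * ‖B₀ p q‖)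
    (hβ0 : 0 ≤ β) :
    (∀ x y, ‖B x y‖ ≤ 16 / 7 * β * ‖x‖ * ‖y‖) ∧
    ∀ x y, ‖x‖ ≤ 1 → ‖y‖ ≤ 1 → ‖B₀ x y‖ = 1 → 1 / 4 * β ≤ ‖B x y‖ := by
  have hup : ∀ x y, ‖B x y‖ ≤ 16 / 7 * β * ‖x‖ * ‖y‖ := by
    intro x y
    have := norm_bilinear_le_of_net B hs hs' ht' (κ := 2 * β) (fun p hp q hq => by
      refine (hβ p hp q hq).2.trans (mul_le_of_le_one_right (by positivity) ?_)
      exact (hB₀ p q).trans (mul_le_one₀ (hs p hp) (norm_nonneg _) (ht q hq))) x y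
    linarith
  refine ⟨hup, fun x y hx hy hxy => ?_⟩
  obtain ⟨p, hp, hxp⟩ := hs' x hx
  obtain ⟨q, hq, hyq⟩ := ht' y hy
  have e : B x y = B p q - (B (p - x) y + B p (q - y)) := by simp
  have e' : B₀ x y = B₀ p q + B₀ (x - p) y + B₀ p (y - q) := by simp; abel
  have h1 : ‖B (p - x) y‖ ≤ 16 / 7 * β * (1 / 16) * 1 :=
    (hup _ _).trans (by rw [norm_sub_rev]; gcongr)
  have h2 : ‖B p (q - y)‖ ≤ 16 / 7 * β * 1 * (1 / 16) :=
    (hup _ _).trans (by rw [norm_sub_rev]; gcongr; exact hs p hp)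
  have h1' : ‖B₀ (x - p) y‖ ≤ 1 / 16 * 1 := (hB₀ _ _).trans (by gcongr)
  have h2' : ‖B₀ p (y - q)‖ ≤ 1 * (1 / 16) := (hB₀ _ _).trans (by gcongr; exact hs p hp)
  have h3 : 1 ≤ ‖B₀ p q‖ + ‖B₀ (x - p) y‖ + ‖B₀ p (y - q)‖ := by
    rw [← hxy, e']; exact norm_add₃_le
  -- The net point has `‖B₀ p q‖ ≥ 7/8`, and the two rounding errors are at most `β/7` each;
  -- `(7/10)(7/8) - 2/7 > 1/4`.
  have h4 := (hβ p hp q hq).1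
  have h5 : 7 / 10 * β * (7 / 8) ≤ 7 / 10 * β * ‖B₀ p q‖ := by gcongr; linarith
  have h6 : ‖B p q‖ - ‖B (p - x) y + B p (q - y)‖ ≤ ‖B x y‖ := by
    rw [e]; exact norm_sub_norm_le _ _
  have h7 := norm_add_le (B (p - x) y) (B p (q - y))
  linarith

/-- Version for a bilinear map into a space `W` without a norm, such as matrices: only the composite
with `L` has to be normed. -/
theorem norm_comp_bilinear_le_of_net {W : Type*} [AddCommGroup W] [Module ℝ W]
    {s : Finset E} {t : Finset F} (β : E →ₗ[ℝ] F →ₗ[ℝ] W) (L : W →ₗ[ℝ] G)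
    (hs : ∀ p ∈ s, ‖p‖ ≤ 1) (hs' : ∀ x : E, ‖x‖ ≤ 1 → ∃ p ∈ s, ‖x - p‖ ≤ 1 / 16)
    (ht' : ∀ x : F, ‖x‖ ≤ 1 → ∃ p ∈ t, ‖x - p‖ ≤ 1 / 16)
    {κ : ℝ} (hκ : ∀ p ∈ s, ∀ q ∈ t, ‖L (β p q)‖ ≤ κ) (x : E) (y : F) :
    ‖L (β x y)‖ ≤ 8 / 7 * κ * ‖x‖ * ‖y‖ :=
  norm_bilinear_le_of_net (β.compr₂ L).toContinuousBilinearMap hs hs' ht' hκ x y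

theorem norm_comp_bilinear_ge_of_net {G' W : Type*} [NormedAddCommGroup G'] [NormedSpace ℝ G']
    [AddCommGroup W] [Module ℝ W] {s : Finset E} {t : Finset F}
    (β : E →ₗ[ℝ] F →ₗ[ℝ] W) (L : W →ₗ[ℝ] G) (L₀ : W →ₗ[ℝ] G')
    (hs : ∀ p ∈ s, ‖p‖ ≤ 1) (hs' : ∀ x : E, ‖x‖ ≤ 1 → ∃ p ∈ s, ‖x - p‖ ≤ 1 / 16)
    (ht : ∀ p ∈ t, ‖p‖ ≤ 1) (ht' : ∀ x : F, ‖x‖ ≤ 1 → ∃ p ∈ t, ‖x - p‖ ≤ 1 / 16)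
    (hβ₀ : ∀ x y, ‖L₀ (β x y)‖ ≤ ‖x‖ * ‖y‖) {c : ℝ}
    (hc : ∀ p ∈ s, ∀ q ∈ t, 7 / 10 * c * ‖L₀ (β p q)‖ ≤ ‖L (β p q)‖ ∧
      ‖L (β p q)‖ ≤ 2 * c * ‖L₀ (β p q)‖)
    (hc0 : 0 ≤ c) :
    (∀ x y, ‖L (β x y)‖ ≤ 16 / 7 * c * ‖x‖ * ‖y‖) ∧
    ∀ x y, ‖x‖ ≤ 1 → ‖y‖ ≤ 1 → ‖L₀ (β x y)‖ = 1 → 1 / 4 * c ≤ ‖L (β x y)‖ :=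
  norm_bilinear_ge_of_net (β.compr₂ L).toContinuousBilinearMap
    (β.compr₂ L₀).toContinuousBilinearMap hs hs' ht ht' hβ₀ hc hc0

end Nets

/-! ### Tail bounds for sums of squares of Gaussian variables -/

section ChiSquare

variable {Ω : Type*} [MeasurableSpace Ω] {P : Measure Ω}

theorem integrable_and_integral_exp_mul_sq_gaussianReal {v : ℝ≥0} (hv : 0 < v) {θ : ℝ}
    (h : 2 * θ * v < 1) :
    Integrable (fun x => Real.exp (θ * x ^ 2)) (gaussianReal 0 v) ∧
    ∫ x, Real.exp (θ * x ^ 2) ∂(gaussianReal 0 v) = √(1 / (1 - 2 * θ * v)) := by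
  have hv' : (0 : ℝ) < v := hv
  have hb : 0 < 1 / (2 * (v : ℝ)) - θ := by
    rw [sub_pos, lt_div_iff₀ (by positivity)]; linarith
  have e : ∀ x : ℝ, gaussianPDFReal 0 v x • Real.exp (θ * x ^ 2)
      = (√(2 * Real.pi * v))⁻¹ * Real.exp (-(1 / (2 * (v : ℝ)) - θ) * x ^ 2) := by
    intro x
    rw [gaussianPDFReal, smul_eq_mul, mul_assoc, ← Real.exp_add]
    congr 2
    field_simp
    ring
  constructor
  · rw [gaussianReal_of_var_ne_zero _ hv.ne', integrable_withDensity_iff_integrable_smul₀'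
      (by fun_prop) (by simp [gaussianPDF])]
    simp only [toReal_gaussianPDF, e]
    exact (integrable_exp_neg_mul_sq hb).const_mul _
  · rw [integral_gaussianReal_eq_integral_smul hv.ne']
    simp only [e]
    rw [integral_const_mul, integral_gaussian, ← Real.sqrt_inv, ← Real.sqrt_mul (by positivity)]
    congr 1
    have : 1 - 2 * θ * v ≠ 0 := by linarith
    have h2 : 1 / (2 * (v : ℝ)) - θ ≠ 0 := hb.ne'
    field_simp

variable {ι : Type*} [Fintype ι] [IsProbabilityMeasure P] {ξ : ι → Ω → ℝ} {v : ℝ≥0}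

/-- Chernoff's bound for a sum of squares of independent centered Gaussian variables. -/
theorem chernoff_sum_sq (hv : 0 < v) (hlaw : ∀ i, HasLaw (ξ i) (gaussianReal 0 v) P)
    (hind : iIndepFun ξ P) {u K b : ℝ} (hu : u < 1)
    (hb : Real.exp (-(u / 2 * K)) * √(1 / (1 - u)) ≤ Real.exp (-b)) :
    P.real {ω | u / 2 * (K * Fintype.card ι * v) ≤ u / 2 * ∑ i, ξ i ω ^ 2}
      ≤ Real.exp (-(b * Fintype.card ι)) := by
  have hv' : (0 : ℝ) < v := hv
  -- The parameter `u = 2θv` is scale-free. Because the event carries the factor `u / 2` on both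
  -- sides, `u > 0` yields an upper tail and `u < 0` a lower tail.
  set θ : ℝ := u / (2 * v) with hθ
  have hθv : 2 * θ * v = u := by rw [hθ]; field_simp
  obtain ⟨hint, hval⟩ := integrable_and_integral_exp_mul_sq_gaussianReal hv (θ := θ)
    (by rw [hθv]; exact hu)
  have hmeas : ∀ i, AEMeasurable (fun ω => ξ i ω ^ 2) P := fun i => (hlaw i).aemeasurable.pow_const 2
  have hmgf : ∀ i, mgf (fun ω => ξ i ω ^ 2) P θ = √(1 / (1 - u)) := by
    intro i
    rw [← hθv, ← hval, ← (hlaw i).map_eq, mgf,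
      integral_map (hlaw i).aemeasurable (by fun_prop)]
  have hinti : ∀ i, Integrable (fun ω => Real.exp (θ * ξ i ω ^ 2)) P := by
    intro i
    have := hint
    rw [← (hlaw i).map_eq] at this
    exact this.comp_aemeasurable (hlaw i).aemeasurable
  have hind2 : iIndepFun (fun i ω => ξ i ω ^ 2) P :=
    hind.comp (fun _ x => x ^ 2) (fun _ => by fun_prop)
  have hsum : mgf (∑ i, fun ω => ξ i ω ^ 2) P θ = √(1 / (1 - u)) ^ Fintype.card ι := by
    rw [hind2.mgf_sum₀ hmeas]
    simp [hmgf]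
  -- The moment generating function of the sum is nonzero by the product formula, whereas it takes
  -- the default value `0` when integrability fails.
  have hintsum : Integrable (fun ω => Real.exp (θ * (∑ i, fun ω => ξ i ω ^ 2) ω)) P := by
    by_contra hcon
    have : mgf (∑ i, fun ω => ξ i ω ^ 2) P θ = 0 := mgf_undef hcon
    rw [hsum] at this
    have h1 : 0 < 1 / (1 - u) := by apply one_div_pos.2; linarith
    have : 0 < √(1 / (1 - u)) ^ Fintype.card ι := by positivity
    linarith
  have hsub : {ω | u / 2 * (K * Fintype.card ι * v) ≤ u / 2 * ∑ i, ξ i ω ^ 2} ⊆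
      {ω | Real.exp (θ * (K * Fintype.card ι * v)) ≤
        Real.exp (θ * (∑ i, fun ω => ξ i ω ^ 2) ω)} := by
    intro ω hω
    have hω' : u / 2 * (K * Fintype.card ι * v) ≤ u / 2 * ∑ i, ξ i ω ^ 2 := hω
    have e1 : ∀ x : ℝ, θ * x = (u / 2 * x) * (1 / v) := by intro x; rw [hθ]; field_simp
    simp only [Set.mem_ofPred_eq, Real.exp_le_exp, Finset.sum_apply]
    rw [e1, e1 (∑ i, ξ i ω ^ 2)]
    gcongr
  have hmarkov := mul_meas_ge_le_integral_of_nonneg (μ := P)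
    (f := fun ω => Real.exp (θ * (∑ i, fun ω => ξ i ω ^ 2) ω))
    (Filter.Eventually.of_forall fun ω => (Real.exp_pos _).le) hintsum
    (Real.exp (θ * (K * Fintype.card ι * v)))
  change _ ≤ mgf (∑ i, fun ω => ξ i ω ^ 2) P θ at hmarkov
  rw [hsum] at hmarkov
  refine (measureReal_mono hsub).trans ?_
  have hpos := Real.exp_pos (θ * (K * Fintype.card ι * v))
  rw [← le_div_iff₀' hpos, div_eq_mul_inv, ← Real.exp_neg] at hmarkov
  refine hmarkov.trans ?_
  have e2 : -(θ * (K * Fintype.card ι * v)) = Fintype.card ι * (-(u / 2 * K)) := by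
    rw [hθ]; field_simp
  have e3 : -(b * Fintype.card ι) = Fintype.card ι * (-b) := by ring
  rw [e2, e3, Real.exp_nat_mul, Real.exp_nat_mul, mul_comm, ← mul_pow]
  gcongr

theorem sqrt_one_div_le_exp {u w : ℝ} (hu : u < 1) (h : 1 ≤ (1 - u) * Real.exp w) :
    √(1 / (1 - u)) ≤ Real.exp (w / 2) := by
  rw [Real.sqrt_le_left (Real.exp_pos _).le, ← Real.exp_nat_mul, div_le_iff₀ (by linarith)]
  have : ((2 : ℕ) : ℝ) * (w / 2) = w := by push_cast; ring
  rw [this]; linarith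

/-- At `u = 3/4` the factor `(1 - u)^(-1/2) = 2` is below `e`, so the exponent per term is at most
`-3/2 + 1`. -/
theorem sum_sq_ge_four (hv : 0 < v) (hlaw : ∀ i, HasLaw (ξ i) (gaussianReal 0 v) P)
    (hind : iIndepFun ξ P) :
    P.real {ω | 4 * (Fintype.card ι * v) ≤ ∑ i, ξ i ω ^ 2}
      ≤ Real.exp (-(1 / 2 * Fintype.card ι)) := by
  refine le_trans (measureReal_mono ?_) (chernoff_sum_sq (u := 3 / 4) (K := 4) (b := 1 / 2) hv hlaw
    hind (by norm_num) ?_)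
  · intro ω hω
    have hω' : 4 * (Fintype.card ι * (v : ℝ)) ≤ ∑ i, ξ i ω ^ 2 := hω
    simp only [Set.mem_ofPred_eq]
    linarith
  · have h2 : √(1 / (1 - 3 / 4 : ℝ)) ≤ Real.exp (2 / 2) := by
      apply sqrt_one_div_le_exp (by norm_num)
      have := Real.quadratic_le_exp_of_nonneg (x := 2) (by norm_num)
      linarith
    calc _ ≤ Real.exp (-(3 / 4 / 2 * 4)) * Real.exp (2 / 2) := by gcongr
      _ = _ := by rw [← Real.exp_add]; norm_num

/-- Choose `u = t/2` and use `-log (1 - u) ≤ u + u²` for `u ≤ 1/2`. -/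
theorem sum_sq_upper_tail (hv : 0 < v) (hlaw : ∀ i, HasLaw (ξ i) (gaussianReal 0 v) P)
    (hind : iIndepFun ξ P) {t : ℝ} (ht : 0 < t) (ht1 : t ≤ 1) :
    P.real {ω | (1 + t) * (Fintype.card ι * v) ≤ ∑ i, ξ i ω ^ 2}
      ≤ Real.exp (-(t ^ 2 / 8 * Fintype.card ι)) := by
  refine le_trans (measureReal_mono ?_) (chernoff_sum_sq (u := t / 2) (K := 1 + t) (b := t ^ 2 / 8)
    hv hlaw hind (by linarith) ?_)
  · intro ω hω
    have hω' : (1 + t) * (Fintype.card ι * (v : ℝ)) ≤ ∑ i, ξ i ω ^ 2 := hω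
    simp only [Set.mem_ofPred_eq, mul_assoc]
    gcongr
  · have h2 : √(1 / (1 - t / 2 : ℝ)) ≤ Real.exp ((t / 2 + (t / 2) ^ 2) / 2) := by
      apply sqrt_one_div_le_exp (by linarith)
      have := Real.quadratic_le_exp_of_nonneg (x := t / 2 + (t / 2) ^ 2) (by positivity)
      set u := t / 2 with hu
      have hu0 : 0 < u := by positivity
      have hu1 : u ≤ 1 / 2 := by linarith
      have h3 : (1 - u) * (1 + (u + u ^ 2) + (u + u ^ 2) ^ 2 / 2) ≤
        (1 - u) * Real.exp (u + u ^ 2) := by gcongr; linarith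
      refine le_trans ?_ h3
      have h4 : 0 ≤ u ^ 2 * ((1 - u) * (1 + u) ^ 2 / 2 - u) := by
        apply mul_nonneg (by positivity)
        nlinarith [mul_nonneg hu0.le (sub_nonneg.2 hu1), mul_nonneg (mul_nonneg hu0.le hu0.le) (sub_nonneg.2 hu1)]
      nlinarith [h4]
    calc _ ≤ Real.exp (-(t / 2 / 2 * (1 + t))) * Real.exp ((t / 2 + (t / 2) ^ 2) / 2) := by gcongr
      _ = _ := by rw [← Real.exp_add]; congr 1; ring

/-- Choose `u = -t` and use `log (1 + t) ≥ t - t²/2`. -/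
theorem sum_sq_lower_tail (hv : 0 < v) (hlaw : ∀ i, HasLaw (ξ i) (gaussianReal 0 v) P)
    (hind : iIndepFun ξ P) {t : ℝ} (ht : 0 < t) :
    P.real {ω | ∑ i, ξ i ω ^ 2 ≤ (1 - t) * (Fintype.card ι * v)}
      ≤ Real.exp (-(t ^ 2 / 4 * Fintype.card ι)) := by
  refine le_trans (measureReal_mono ?_) (chernoff_sum_sq (u := -t) (K := 1 - t) (b := t ^ 2 / 4)
    hv hlaw hind (by linarith) ?_)
  · intro ω hω
    have hω' : ∑ i, ξ i ω ^ 2 ≤ (1 - t) * (Fintype.card ι * (v : ℝ)) := hω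
    simp only [Set.mem_ofPred_eq, mul_assoc]
    apply mul_le_mul_of_nonpos_left hω'
    linarith
  · have h2 : √(1 / (1 - -t : ℝ)) ≤ Real.exp ((-t + t ^ 2 / 2) / 2) := by
      apply sqrt_one_div_le_exp (by linarith)
      have h3 : t - t ^ 2 / 2 ≤ Real.log (1 + t) := by
        refine le_trans ?_ (Real.le_log_one_add_of_nonneg ht.le)
        rw [le_div_iff₀ (by linarith)]
        nlinarith [pow_pos ht 3]
      have h4 := Real.exp_le_exp.2 h3
      rw [Real.exp_log (by linarith)] at h4
      have e : -t + t ^ 2 / 2 = -(t - t ^ 2 / 2) := by ring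
      rw [e, Real.exp_neg, sub_neg_eq_add, ← div_eq_mul_inv, le_div_iff₀ (Real.exp_pos _)]
      linarith
    calc _ ≤ Real.exp (-(-t / 2 * (1 - t))) * Real.exp ((-t + t ^ 2 / 2) / 2) := by gcongr
      _ = _ := by rw [← Real.exp_add]; congr 1; ring

end ChiSquare

/-! ### Linear combinations of independent Gaussian variables -/

section GaussianCombinations

variable {Ω : Type*} [MeasurableSpace Ω] {P : Measure Ω} [IsProbabilityMeasure P]

omit [IsProbabilityMeasure P] in
-- Merges the entries of the measurement matrices and the noise into one independent family.
theorem iIndepFun_sumElim {ι κ : Type*} [Fintype ι] [Fintype κ] {f : ι → Ω → ℝ} {g : κ → Ω → ℝ}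
    (hf : iIndepFun f P) (hg : iIndepFun g P)
    (hfg : IndepFun (fun ω i => f i ω) (fun ω j => g j ω) P) :
    iIndepFun (Sum.elim f g) P := by
  classical
  rw [iIndepFun_iff_measure_inter_preimage_eq_mul]
  intro S sets hS
  have e : (⋂ i ∈ S, Sum.elim f g i ⁻¹' sets i) =
      ((fun ω i => f i ω) ⁻¹' (⋂ i ∈ S.toLeft, {x | x i ∈ sets (.inl i)})) ∩
      ((fun ω j => g j ω) ⁻¹' (⋂ j ∈ S.toRight, {x | x j ∈ sets (.inr j)})) := by
    ext ω
    simp [Sum.forall]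
  rw [e, hfg.measure_inter_preimage_eq_mul]
  · have h1 := (iIndepFun_iff_measure_inter_preimage_eq_mul.1 hf) S.toLeft
      (sets := fun i => sets (.inl i)) (fun i hi => hS _ (Finset.mem_toLeft.1 hi))
    have h2 := (iIndepFun_iff_measure_inter_preimage_eq_mul.1 hg) S.toRight
      (sets := fun i => sets (.inr i)) (fun i hi => hS _ (Finset.mem_toRight.1 hi))
    have e1 : (fun ω i => f i ω) ⁻¹' (⋂ i ∈ S.toLeft, {x | x i ∈ sets (.inl i)}) =
        ⋂ i ∈ S.toLeft, f i ⁻¹' sets (.inl i) := by ext; simp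
    have e2 : (fun ω i => g i ω) ⁻¹' (⋂ i ∈ S.toRight, {x | x i ∈ sets (.inr i)}) =
        ⋂ i ∈ S.toRight, g i ⁻¹' sets (.inr i) := by ext; simp
    rw [e1, e2, h1, h2]
    conv_rhs => rw [← Finset.toLeft_disjSum_toRight (u := S), Finset.prod_disjSum]
    rfl
  · exact Finset.measurableSet_biInter _ fun i hi =>
      (hS _ (Finset.mem_toLeft.1 hi)).preimage (measurable_pi_apply i)
  · exact Finset.measurableSet_biInter _ fun i hi =>
      (hS _ (Finset.mem_toRight.1 hi)).preimage (measurable_pi_apply i)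

variable {K ι : Type*} [Fintype K] [Fintype ι] {W : K → Ω → ℝ} {v : K → ℝ≥0}

theorem covariance_linear_combination (hlaw : ∀ a, HasLaw (W a) (gaussianReal 0 (v a)) P)
    (hind : iIndepFun W P) (c d : K → ℝ) :
    cov[fun ω => ∑ a, c a * W a ω, fun ω => ∑ a, d a * W a ω; P] = ∑ a, c a * d a * v a := by
  classical
  have hL : ∀ a, MemLp (W a) 2 P := fun a => (hlaw a).hasGaussianLaw.memLp_two
  rw [covariance_fun_sum_fun_sum (fun a => (hL a).const_mul _) (fun a => (hL a).const_mul _)]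
  refine Finset.sum_congr rfl fun a _ => ?_
  rw [Finset.sum_eq_single a]
  · rw [covariance_const_mul_left, covariance_const_mul_right,
      covariance_self (hlaw a).aemeasurable, (hlaw a).variance_eq, variance_id_gaussianReal]
    ring
  · intro b _ hb
    rw [covariance_const_mul_left, covariance_const_mul_right,
      (hind.indepFun hb.symm).covariance_eq_zero (hL a) (hL b)]
    ring
  · simp

/-- Orthogonal linear combinations of independent centered Gaussian variables are independent
centered Gaussian variables. -/
theorem gaussian_linear_combinations (hlaw : ∀ a, HasLaw (W a) (gaussianReal 0 (v a)) P)
    (hind : iIndepFun W P) (c : ι → K → ℝ) (V : ℝ≥0)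
    (hV : ∀ i, ∑ a, c i a * c i a * v a = V)
    (hort : ∀ i j, i ≠ j → ∑ a, c i a * c j a * v a = 0) :
    (∀ i, HasLaw (fun ω => ∑ a, c i a * W a ω) (gaussianReal 0 V) P) ∧
    iIndepFun (fun i ω => ∑ a, c i a * W a ω) P := by
  -- Joint Gaussianity is what makes vanishing covariances sufficient for independence.
  have hW : HasGaussianLaw (fun ω a => W a ω) P :=
    iIndepFun.hasGaussianLaw (fun a => (hlaw a).hasGaussianLaw) hind
  let L : (K → ℝ) →L[ℝ] (ι → ℝ) :=
    ContinuousLinearMap.pi fun i => ∑ a, c i a • ContinuousLinearMap.proj a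
  have hY : HasGaussianLaw (fun ω i => ∑ a, c i a * W a ω) P := by
    have := hW.map_fun L
    have e : (fun ω => L (fun a => W a ω)) = fun ω i => ∑ a, c i a * W a ω := by
      ext ω i; simp [L]
    rwa [e] at this
  refine ⟨fun i => ?_, ?_⟩
  · have hi : HasGaussianLaw (fun ω => ∑ a, c i a * W a ω) P := hY.eval i
    refine ⟨hi.aemeasurable, ?_⟩
    rw [hi.map_eq_gaussianReal]
    congr 1
    · rw [integral_finsetSum]
      · refine Finset.sum_eq_zero fun a _ => ?_
        rw [integral_const_mul, (hlaw a).integral_eq]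
        simp
      · exact fun a _ => ((hlaw a).hasGaussianLaw.integrable).const_mul _
    · rw [← covariance_self hi.aemeasurable, covariance_linear_combination hlaw hind, hV]
      simp
  · refine hY.iIndepFun_of_covariance_eq_zero fun i j hij => ?_
    rw [covariance_linear_combination hlaw hind, hort i j hij]

end GaussianCombinations

/-! ### Gaussian measurements of a fixed matrix -/

section Ensemble

variable {n₁ n₂ m : ℕ}

/-- The Frobenius inner product. -/
def frobeniusInner (X Y : Matrix (Fin n₁) (Fin n₂) ℝ) : ℝ := ∑ j, ∑ k, X j k * Y j k

theorem frobeniusNorm_sq (X : Matrix (Fin n₁) (Fin n₂) ℝ) :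
    frobeniusNorm X ^ 2 = ∑ j, ∑ k, X j k ^ 2 :=
  Real.sq_sqrt (by positivity)

theorem frobeniusNorm_sq_eq_inner (X : Matrix (Fin n₁) (Fin n₂) ℝ) :
    frobeniusNorm X ^ 2 = frobeniusInner X X := by
  rw [frobeniusNorm_sq]; simp [frobeniusInner, sq]

theorem frobeniusNorm_nonneg (X : Matrix (Fin n₁) (Fin n₂) ℝ) : 0 ≤ frobeniusNorm X :=
  Real.sqrt_nonneg _

theorem measurementMap_apply (A : Fin m → Matrix (Fin n₁) (Fin n₂) ℝ)
    (X : Matrix (Fin n₁) (Fin n₂) ℝ) (i : Fin m) :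
    measurementMap A X i = ∑ j, ∑ k, A i j k * X j k := by
  simp only [measurementMap, Matrix.trace, Matrix.diag, Matrix.mul_apply, Matrix.transpose_apply]
  exact Finset.sum_comm

theorem measurementMap_add (A : Fin m → Matrix (Fin n₁) (Fin n₂) ℝ)
    (X Y : Matrix (Fin n₁) (Fin n₂) ℝ) :
    measurementMap A (X + Y) = measurementMap A X + measurementMap A Y := by
  ext i; simp [measurementMap_apply, mul_add, Finset.sum_add_distrib]

theorem measurementMap_sub (A : Fin m → Matrix (Fin n₁) (Fin n₂) ℝ)
    (X Y : Matrix (Fin n₁) (Fin n₂) ℝ) :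
    measurementMap A (X - Y) = measurementMap A X - measurementMap A Y := by
  ext i; simp [measurementMap_apply, mul_sub]

theorem measurementMap_smul (A : Fin m → Matrix (Fin n₁) (Fin n₂) ℝ) (c : ℝ)
    (X : Matrix (Fin n₁) (Fin n₂) ℝ) :
    measurementMap A (c • X) = c • measurementMap A X := by
  ext i; simp [measurementMap]

theorem measurementAdjoint_apply (A : Fin m → Matrix (Fin n₁) (Fin n₂) ℝ) (q : Fin m → ℝ)
    (j : Fin n₁) (k : Fin n₂) : measurementAdjoint A q j k = ∑ i, q i * A i j k := by
  simp [measurementAdjoint, Matrix.sum_apply]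

/-- The two maps are adjoint to each other. -/
theorem frobeniusInner_measurementAdjoint (A : Fin m → Matrix (Fin n₁) (Fin n₂) ℝ) (q : Fin m → ℝ)
    (X : Matrix (Fin n₁) (Fin n₂) ℝ) :
    frobeniusInner X (measurementAdjoint A q) = ∑ i, measurementMap A X i * q i := by
  simp only [frobeniusInner, measurementAdjoint_apply, measurementMap_apply, Finset.mul_sum,
    Finset.sum_mul]
  rw [Finset.sum_comm (s := (Finset.univ : Finset (Fin m)))]
  refine Finset.sum_congr rfl fun j _ => ?_
  rw [Finset.sum_comm (s := (Finset.univ : Finset (Fin m)))]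
  exact Finset.sum_congr rfl fun k _ => Finset.sum_congr rfl fun i _ => by ring

variable {Ω : Type*} [MeasurableSpace Ω] {P : Measure Ω} [IsProbabilityMeasure P]
  {A : Ω → Fin m → Matrix (Fin n₁) (Fin n₂) ℝ} {z : Ω → Fin m → ℝ} {σ : ℝ≥0}

/-- The noisy measurements of a fixed matrix are independent Gaussian variables. -/
theorem gaussian_measurementMap (hA : IsGaussianEnsemble P A) (hz : IsGaussianNoise P σ z)
    (hAz : IndepFun (fun (ω : Ω) (p : Fin m × Fin n₁ × Fin n₂) => A ω p.1 p.2.1 p.2.2) z P)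
    (X : Matrix (Fin n₁) (Fin n₂) ℝ) (s : ℝ) (V : ℝ≥0)
    (hV : (V : ℝ) = frobeniusNorm X ^ 2 / m + s ^ 2 * σ ^ 2) :
    (∀ i, HasLaw (fun ω => measurementMap (A ω) X i + s * z ω i) (gaussianReal 0 V) P) ∧
    iIndepFun (fun i ω => measurementMap (A ω) X i + s * z ω i) P := by
  classical
  let W : (Fin m × Fin n₁ × Fin n₂) ⊕ Fin m → Ω → ℝ :=
    Sum.elim (fun p ω => A ω p.1 p.2.1 p.2.2) (fun i ω => z ω i)
  have hind : iIndepFun W P := iIndepFun_sumElim hA.indep hz.indep hAz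
  have hlaw : ∀ a, HasLaw (W a) (gaussianReal 0
      (Sum.elim (fun _ => (m : ℝ≥0)⁻¹) (fun _ => σ ^ 2) a)) P := by
    rintro (p | i)
    · exact hA.law _ _ _
    · exact hz.law _
  let c : Fin m → (Fin m × Fin n₁ × Fin n₂) ⊕ Fin m → ℝ := fun i =>
    Sum.elim (fun p => if p.1 = i then X p.2.1 p.2.2 else 0) (fun i' => if i' = i then s else 0)
  have := gaussian_linear_combinations (ι := Fin m) hlaw hind c V ?_ ?_
  · have e : ∀ i ω, ∑ a, c i a * W a ω = measurementMap (A ω) X i + s * z ω i := by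
      intro i ω
      simp [c, W, Fintype.sum_sum_type, Fintype.sum_prod_type, measurementMap_apply, mul_comm,
        Finset.sum_ite_irrel]
    simpa only [e] using this
  · intro i
    rw [hV, frobeniusNorm_sq]
    simp [c, Fintype.sum_sum_type, Fintype.sum_prod_type, Finset.sum_ite_irrel, Finset.sum_mul, sq,
      div_eq_mul_inv]
  · intro i j hij
    simp [c, Fintype.sum_sum_type, Fintype.sum_prod_type, Finset.sum_ite_irrel, hij.symm]

/-- The entries of the adjoint at a fixed vector are independent Gaussian variables. -/
theorem gaussian_measurementAdjoint (hA : IsGaussianEnsemble P A) (q : Fin m → ℝ) (V : ℝ≥0)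
    (hV : (V : ℝ) = (∑ i, q i ^ 2) / m) :
    (∀ p : Fin n₁ × Fin n₂, HasLaw (fun ω => measurementAdjoint (A ω) q p.1 p.2)
      (gaussianReal 0 V) P) ∧
    iIndepFun (fun (p : Fin n₁ × Fin n₂) ω => measurementAdjoint (A ω) q p.1 p.2) P := by
  classical
  let c : Fin n₁ × Fin n₂ → Fin m × Fin n₁ × Fin n₂ → ℝ := fun p a =>
    if a.2 = p then q a.1 else 0
  have := gaussian_linear_combinations (fun a => hA.law a.1 a.2.1 a.2.2) hA.indep c V ?_ ?_
  · have e : ∀ (p : Fin n₁ × Fin n₂) ω, ∑ a : Fin m × Fin n₁ × Fin n₂,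
        c p a * A ω a.1 a.2.1 a.2.2 = measurementAdjoint (A ω) q p.1 p.2 := by
      intro p ω
      rw [Fintype.sum_prod_type]
      simp [c, measurementAdjoint_apply]
    simpa only [e] using this
  · intro p
    rw [Fintype.sum_prod_type]
    simp [c, hV, Finset.sum_mul, sq, div_eq_mul_inv]
  · intro p p' hp
    rw [Fintype.sum_prod_type]
    simp [c, hp.symm]

/-- The sum of squares of `N` independent Gaussian variables of variance `v` lies between
`N v / 2` and `4 N v` up to an exponentially small probability. -/
theorem sum_sq_distortion {ι : Type*} [Fintype ι] {ξ : ι → Ω → ℝ} {v : ℝ≥0} (hv : 0 < v)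
    (hlaw : ∀ i, HasLaw (ξ i) (gaussianReal 0 v) P) (hind : iIndepFun ξ P) {N : ℕ}
    (hN : Fintype.card ι = N) :
    P.real {ω | ¬ (49 / 100 * (N * v) ≤ ∑ i, ξ i ω ^ 2 ∧ ∑ i, ξ i ω ^ 2 ≤ 4 * (N * v))} ≤
      2 * Real.exp (-(1 / 16 * N)) := by
  subst hN
  have h1 := sum_sq_lower_tail hv hlaw hind (t := 1 / 2) (by norm_num)
  have h2 := sum_sq_ge_four hv hlaw hind
  have h3 : Real.exp (-(1 / 2 * Fintype.card ι)) ≤ Real.exp (-(1 / 16 * (Fintype.card ι : ℝ))) := by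
    apply Real.exp_le_exp.2
    have : (0 : ℝ) ≤ Fintype.card ι := by positivity
    linarith
  refine (measureReal_mono ?_).trans ((measureReal_union_le _ _).trans
    ((add_le_add h1 h2).trans ?_))
  · intro ω hω
    simp only [Set.mem_ofPred_eq, not_and_or, not_le] at hω
    have h0 : (0 : ℝ) ≤ Fintype.card ι * v := by positivity
    rcases hω with h | h
    · left; simp only [Set.mem_ofPred_eq]; linarith
    · right; simp only [Set.mem_ofPred_eq]; linarith
  · have e : ((1 / 2) ^ 2 / 4 : ℝ) = 1 / 16 := by norm_num
    rw [e]; linarith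

/-- A fixed matrix has a distorted measurement only with exponentially small probability. -/
theorem measurementMap_distortion (hA : IsGaussianEnsemble P A) (hz : IsGaussianNoise P σ z)
    (hAz : IndepFun (fun (ω : Ω) (p : Fin m × Fin n₁ × Fin n₂) => A ω p.1 p.2.1 p.2.2) z P)
    (hm : 0 < m) (X : Matrix (Fin n₁) (Fin n₂) ℝ) :
    P.real {ω | ¬ (49 / 100 * frobeniusNorm X ^ 2 ≤ ∑ i, measurementMap (A ω) X i ^ 2 ∧
      ∑ i, measurementMap (A ω) X i ^ 2 ≤ 4 * frobeniusNorm X ^ 2)} ≤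
      2 * Real.exp (-(1 / 16 * m)) := by
  have hm' : (0 : ℝ) < m := by exact_mod_cast hm
  rcases (sq_nonneg (frobeniusNorm X)).eq_or_lt with h0 | h0
  · have hX : X = 0 := by
      ext j k
      rw [frobeniusNorm_sq, eq_comm, Finset.sum_eq_zero_iff_of_nonneg (by intros; positivity)] at h0
      have h1 := h0 j (Finset.mem_univ _)
      rw [Finset.sum_eq_zero_iff_of_nonneg (by intros; positivity)] at h1
      simpa using h1 k (Finset.mem_univ _)
    subst hX
    rw [← h0]
    simp only [measurementMap_apply]
    simp
    positivity
  · obtain ⟨V, hV⟩ : ∃ V : ℝ≥0, (V : ℝ) = frobeniusNorm X ^ 2 / m :=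
      ⟨_, Real.coe_toNNReal _ (by positivity)⟩
    obtain ⟨hl, hi⟩ := gaussian_measurementMap hA hz hAz X 0 V (by simp [hV])
    have := sum_sq_distortion (by rw [← NNReal.coe_pos, hV]; exact div_pos h0 hm') hl hi
      (Fintype.card_fin m)
    have e : (m : ℝ) * (frobeniusNorm X ^ 2 / m) = frobeniusNorm X ^ 2 := by field_simp
    simpa only [zero_mul, add_zero, hV, e] using this

/-- The dual of `measurementMap_distortion`: the `n₁ n₂` entries of `𝒜^*(q)` are independent with
variance `‖q‖² / m`. This is the source of the quotient property. -/
theorem measurementAdjoint_distortion (hA : IsGaussianEnsemble P A) (hm : 0 < m) (q : Fin m → ℝ) :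
    P.real {ω | ¬ (49 / 100 * ((n₁ * n₂ : ℕ) / m * ∑ i, q i ^ 2) ≤
        frobeniusNorm (measurementAdjoint (A ω) q) ^ 2 ∧
      frobeniusNorm (measurementAdjoint (A ω) q) ^ 2 ≤ 4 * ((n₁ * n₂ : ℕ) / m * ∑ i, q i ^ 2))} ≤
      2 * Real.exp (-(1 / 16 * (n₁ * n₂ : ℕ))) := by
  have hm' : (0 : ℝ) < m := by exact_mod_cast hm
  have hq : 0 ≤ ∑ i, q i ^ 2 := by positivity
  rcases hq.eq_or_lt with h0 | h0
  · have hq0 : q = 0 := by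
      ext i
      rw [eq_comm, Finset.sum_eq_zero_iff_of_nonneg (by intros; positivity)] at h0
      simpa using h0 i (Finset.mem_univ _)
    subst hq0
    simp only [frobeniusNorm_sq, measurementAdjoint_apply]
    simp
    positivity
  · obtain ⟨V, hV⟩ : ∃ V : ℝ≥0, (V : ℝ) = (∑ i, q i ^ 2) / m :=
      ⟨_, Real.coe_toNNReal _ (by positivity)⟩
    obtain ⟨hl, hi⟩ := gaussian_measurementAdjoint hA q V hV
    have := sum_sq_distortion (by rw [← NNReal.coe_pos, hV]; exact div_pos h0 hm') hl hi
      (N := n₁ * n₂) (by simp)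
    have e : ((n₁ * n₂ : ℕ) : ℝ) * ((∑ i, q i ^ 2) / m) = (n₁ * n₂ : ℕ) / m * ∑ i, q i ^ 2 := by
      field_simp
    simpa only [hV, e, Fintype.sum_prod_type, ← frobeniusNorm_sq] using this

theorem frobeniusNorm_add_sq_add_sub_sq (X Y : Matrix (Fin n₁) (Fin n₂) ℝ) :
    frobeniusNorm (X + Y) ^ 2 + frobeniusNorm (X - Y) ^ 2 =
      2 * frobeniusNorm X ^ 2 + 2 * frobeniusNorm Y ^ 2 := by
  simp only [frobeniusNorm_sq, Finset.mul_sum, ← Finset.sum_add_distrib]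
  exact Finset.sum_congr rfl fun j _ => Finset.sum_congr rfl fun k _ => by simp; ring

theorem frobeniusNorm_add_sq_sub_sub_sq (X Y : Matrix (Fin n₁) (Fin n₂) ℝ) :
    frobeniusNorm (X + Y) ^ 2 - frobeniusNorm (X - Y) ^ 2 = 4 * frobeniusInner X Y := by
  simp only [frobeniusNorm_sq, frobeniusInner, Finset.mul_sum, ← Finset.sum_sub_distrib]
  exact Finset.sum_congr rfl fun j _ => Finset.sum_congr rfl fun k _ => by simp; ring

theorem frobeniusNorm_smul (c : ℝ) (X : Matrix (Fin n₁) (Fin n₂) ℝ) :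
    frobeniusNorm (c • X) = |c| * frobeniusNorm X := by
  rw [← Real.sqrt_sq (frobeniusNorm_nonneg (c • X)), ← Real.sqrt_sq (frobeniusNorm_nonneg X),
    ← Real.sqrt_sq_eq_abs, ← Real.sqrt_mul (sq_nonneg c), frobeniusNorm_sq, frobeniusNorm_sq]
  simp [mul_pow, Finset.mul_sum]

theorem frobeniusInner_smul_left (c : ℝ) (X Y : Matrix (Fin n₁) (Fin n₂) ℝ) :
    frobeniusInner (c • X) Y = c * frobeniusInner X Y := by
  simp [frobeniusInner, Finset.mul_sum, mul_assoc]

/-- The measurements of a fixed matrix `X` have a correlation close to `⟨X, T⟩` with the noisy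
measurements of a fixed matrix `T`. -/
theorem measurementMap_correlation (hA : IsGaussianEnsemble P A) (hz : IsGaussianNoise P σ z)
    (hAz : IndepFun (fun (ω : Ω) (p : Fin m × Fin n₁ × Fin n₂) => A ω p.1 p.2.1 p.2.2) z P)
    (hσ : 0 < σ) {n : ℕ} (hn : 0 < n) (hnm : 100 * n ≤ m) (X T : Matrix (Fin n₁) (Fin n₂) ℝ)
    (hX : frobeniusNorm X ≤ 1) (hT : frobeniusNorm T ^ 2 ≤ m * σ ^ 2 / 5) :
    P.real {ω | ¬ |∑ i, measurementMap (A ω) X i * (measurementMap (A ω) T i + z ω i)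
        - frobeniusInner X T| ≤ 11 * √n * σ} ≤ 4 * Real.exp (-(25 / 2 * n)) := by
  have hn' : (0 : ℝ) < n := by exact_mod_cast hn
  have hm' : (0 : ℝ) < m := by exact_mod_cast (by omega : 0 < m)
  have hnm' : 100 * (n : ℝ) ≤ m := by exact_mod_cast hnm
  have hσ' : (0 : ℝ) < σ := hσ
  -- Polarization: the correlation is a difference of sums of squares for `αX ± T` with noise `±z`.
  -- This `α` balances `αX`, whose measurements have variance at most `σ²`, against the noise.
  set α : ℝ := σ * √m with hα
  have hαpos : 0 < α := by positivity
  have hα2 : α ^ 2 = m * σ ^ 2 := by rw [hα, mul_pow, Real.sq_sqrt hm'.le]; ring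
  -- Chosen so that the tail exponent `t² m / 8` equals `25 n / 2`.
  set t : ℝ := 10 * (√n / √m) with ht
  have htpos : 0 < t := by positivity
  have ht2 : t ^ 2 * m = 100 * n := by
    rw [ht, mul_pow, div_pow, Real.sq_sqrt hn'.le, Real.sq_sqrt hm'.le]; field_simp; norm_num
  have ht1 : t ≤ 1 := by
    rw [← abs_of_pos htpos, ← sq_le_one_iff_abs_le_one]
    by_contra! h
    nlinarith
  have htα : t * α = 10 * √n * σ := by rw [ht, hα]; field_simp
  obtain ⟨V₁, hV₁⟩ : ∃ V : ℝ≥0, (V : ℝ) = frobeniusNorm (α • X + T) ^ 2 / m + 1 ^ 2 * σ ^ 2 :=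
    ⟨_, Real.coe_toNNReal _ (by positivity)⟩
  obtain ⟨V₂, hV₂⟩ : ∃ V : ℝ≥0, (V : ℝ) = frobeniusNorm (α • X - T) ^ 2 / m + (-1) ^ 2 * σ ^ 2 :=
    ⟨_, Real.coe_toNNReal _ (by positivity)⟩
  obtain ⟨hl₁, hi₁⟩ := gaussian_measurementMap hA hz hAz (α • X + T) 1 V₁ hV₁
  obtain ⟨hl₂, hi₂⟩ := gaussian_measurementMap hA hz hAz (α • X - T) (-1) V₂ hV₂
  have hv₁ : 0 < V₁ := by rw [← NNReal.coe_pos, hV₁]; positivity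
  have hv₂ : 0 < V₂ := by rw [← NNReal.coe_pos, hV₂]; positivity
  have a1 := sum_sq_upper_tail hv₁ hl₁ hi₁ htpos ht1
  have a2 := sum_sq_lower_tail hv₁ hl₁ hi₁ htpos
  have a3 := sum_sq_upper_tail hv₂ hl₂ hi₂ htpos ht1
  have a4 := sum_sq_lower_tail hv₂ hl₂ hi₂ htpos
  simp only [Fintype.card_fin, hV₁, hV₂] at a1 a2 a3 a4
  have e1 : t ^ 2 / 8 * m = 25 / 2 * n := by linarith
  have e2 : Real.exp (-(t ^ 2 / 4 * m)) ≤ Real.exp (-(25 / 2 * n)) :=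
    Real.exp_le_exp.2 (by linarith)
  rw [e1] at a1 a3
  refine (measureReal_mono ?_).trans ((measureReal_union_le _ _).trans
    ((add_le_add ((measureReal_union_le _ _).trans (add_le_add a1 (a2.trans e2)))
      ((measureReal_union_le _ _).trans (add_le_add a3 (a4.trans e2)))).trans (by linarith)))
  intro ω hω
  by_contra hcon
  simp only [Set.mem_union, Set.mem_ofPred_eq, not_or, not_le] at hcon
  obtain ⟨⟨b1, b2⟩, b3, b4⟩ := hcon
  apply hω
  have c1 : (m : ℝ) * (frobeniusNorm (α • X + T) ^ 2 / m + 1 ^ 2 * σ ^ 2) =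
      frobeniusNorm (α • X + T) ^ 2 + m * σ ^ 2 := by field_simp
  have c2 : (m : ℝ) * (frobeniusNorm (α • X - T) ^ 2 / m + (-1) ^ 2 * σ ^ 2) =
      frobeniusNorm (α • X - T) ^ 2 + m * σ ^ 2 := by field_simp
  rw [c1] at b1 b2
  rw [c2] at b3 b4
  have p1 := frobeniusNorm_add_sq_add_sub_sq (α • X) T
  have p2 := frobeniusNorm_add_sq_sub_sub_sq (α • X) T
  rw [frobeniusNorm_smul, mul_pow, sq_abs] at p1
  rw [frobeniusInner_smul_left] at p2
  have hX2 : frobeniusNorm X ^ 2 ≤ 1 := pow_le_one₀ (frobeniusNorm_nonneg X) hX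
  have p3 : ∑ i, (measurementMap (A ω) (α • X + T) i + 1 * z ω i) ^ 2 -
      ∑ i, (measurementMap (A ω) (α • X - T) i + -1 * z ω i) ^ 2 =
      4 * α * ∑ i, measurementMap (A ω) X i * (measurementMap (A ω) T i + z ω i) := by
    rw [← Finset.sum_sub_distrib, Finset.mul_sum]
    refine Finset.sum_congr rfl fun i _ => ?_
    simp only [measurementMap_add, measurementMap_sub, measurementMap_smul, Pi.add_apply,
      Pi.sub_apply, Pi.smul_apply, smul_eq_mul]
    ring
  set S := ∑ i, measurementMap (A ω) X i * (measurementMap (A ω) T i + z ω i)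
  set u := frobeniusNorm (α • X + T) ^ 2
  set w := frobeniusNorm (α • X - T) ^ 2
  -- By the parallelogram law the two variances, times `m`, add up to at most `(2 + 2/5 + 2) α²`.
  -- The relative error `t` of this sum, divided by `4α`, gives `11 √n σ`.
  have hsum : u + w + 2 * (m * σ ^ 2) ≤ 22 / 5 * α ^ 2 := by
    have : α ^ 2 * frobeniusNorm X ^ 2 ≤ α ^ 2 * 1 := by gcongr
    linarith
  have hsum' : t * (u + w + 2 * (m * σ ^ 2)) ≤ 4 * α * (11 * √n * σ) := by
    calc _ ≤ t * (22 / 5 * α ^ 2) := by gcongr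
      _ = 22 / 5 * α * (t * α) := by ring
      _ = _ := by rw [htα]; ring
  have h4α : 0 < 4 * α := by positivity
  rw [abs_le]
  constructor
  · refine le_of_mul_le_mul_left ?_ h4α
    linarith
  · refine le_of_mul_le_mul_left ?_ h4α
    linarith

end Ensemble

/-! ### Singular bases and the nuclear norm -/

section SingularBasis

open scoped InnerProductSpace

variable {n₁ n₂ m : ℕ}

/-- The entries of a matrix as a Euclidean vector. -/
def vec : Matrix (Fin n₁) (Fin n₂) ℝ →ₗ[ℝ] EuclideanSpace ℝ (Fin n₁ × Fin n₂) where
  toFun X := WithLp.toLp 2 fun p => X p.1 p.2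
  map_add' _ _ := rfl
  map_smul' _ _ := rfl

theorem norm_vec (X : Matrix (Fin n₁) (Fin n₂) ℝ) : ‖vec X‖ = frobeniusNorm X := by
  rw [EuclideanSpace.norm_eq, frobeniusNorm, Fintype.sum_prod_type]
  simp only [Real.norm_eq_abs, sq_abs]
  rfl

theorem inner_vec (X Y : Matrix (Fin n₁) (Fin n₂) ℝ) : ⟪vec X, vec Y⟫_ℝ = frobeniusInner X Y := by
  rw [PiLp.inner_apply, frobeniusInner, Fintype.sum_prod_type]
  exact Finset.sum_congr rfl fun j _ => Finset.sum_congr rfl fun k _ => mul_comm _ _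

theorem frobeniusInner_le (X Y : Matrix (Fin n₁) (Fin n₂) ℝ) :
    frobeniusInner X Y ≤ frobeniusNorm X * frobeniusNorm Y := by
  rw [← inner_vec, ← norm_vec, ← norm_vec]; exact real_inner_le_norm _ _

theorem frobeniusNorm_add_le (X Y : Matrix (Fin n₁) (Fin n₂) ℝ) :
    frobeniusNorm (X + Y) ≤ frobeniusNorm X + frobeniusNorm Y := by
  simp only [← norm_vec, map_add]; exact norm_add_le _ _

theorem frobeniusInner_add_left (X Y Z : Matrix (Fin n₁) (Fin n₂) ℝ) :
    frobeniusInner (X + Y) Z = frobeniusInner X Z + frobeniusInner Y Z := by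
  simp only [← inner_vec, map_add, inner_add_left]

theorem frobeniusInner_add_right (X Y Z : Matrix (Fin n₁) (Fin n₂) ℝ) :
    frobeniusInner X (Y + Z) = frobeniusInner X Y + frobeniusInner X Z := by
  simp only [← inner_vec, map_add, inner_add_right]

theorem frobeniusInner_neg_left (X Y : Matrix (Fin n₁) (Fin n₂) ℝ) :
    frobeniusInner (-X) Y = -frobeniusInner X Y := by
  simp only [← inner_vec, map_neg, inner_neg_left]

theorem frobeniusInner_comm (X Y : Matrix (Fin n₁) (Fin n₂) ℝ) :
    frobeniusInner X Y = frobeniusInner Y X := by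
  rw [← inner_vec, real_inner_comm, inner_vec]

/-- The Frobenius inner product can be computed in any orthonormal basis. -/
theorem frobeniusInner_eq_sum (X Y : Matrix (Fin n₁) (Fin n₂) ℝ)
    (v : OrthonormalBasis (Fin n₂) ℝ (EuclideanSpace ℝ (Fin n₂))) :
    frobeniusInner X Y =
      ∑ i, ⟪Matrix.toEuclideanLin X (v i), Matrix.toEuclideanLin Y (v i)⟫_ℝ := by
  have h : ∀ b : OrthonormalBasis (Fin n₂) ℝ (EuclideanSpace ℝ (Fin n₂)),
      ∑ i, ⟪Matrix.toEuclideanLin X (b i), Matrix.toEuclideanLin Y (b i)⟫_ℝ =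
      LinearMap.trace ℝ _ ((Matrix.toEuclideanLin X).adjoint ∘ₗ Matrix.toEuclideanLin Y) := by
    intro b
    rw [LinearMap.trace_eq_sum_inner _ b]
    refine Finset.sum_congr rfl fun i _ => ?_
    rw [LinearMap.comp_apply, LinearMap.adjoint_inner_right]
  rw [h, ← h (EuclideanSpace.basisFun (Fin n₂) ℝ)]
  simp only [frobeniusInner]
  rw [Finset.sum_comm]
  refine Finset.sum_congr rfl fun k _ => ?_
  simp [PiLp.inner_apply, mul_comm]

theorem frobeniusNorm_sq_eq_sum (X : Matrix (Fin n₁) (Fin n₂) ℝ)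
    (v : OrthonormalBasis (Fin n₂) ℝ (EuclideanSpace ℝ (Fin n₂))) :
    frobeniusNorm X ^ 2 = ∑ i, ‖Matrix.toEuclideanLin X (v i)‖ ^ 2 := by
  rw [frobeniusNorm_sq_eq_inner, frobeniusInner_eq_sum X X v]
  simp

theorem opNorm_nonneg (X : Matrix (Fin n₁) (Fin n₂) ℝ) : 0 ≤ opNorm X := norm_nonneg _

theorem norm_toEuclideanLin_le (X : Matrix (Fin n₁) (Fin n₂) ℝ) (x) :
    ‖Matrix.toEuclideanLin X x‖ ≤ opNorm X * ‖x‖ :=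
  (Matrix.toEuclideanLin X).toContinuousLinearMap.le_opNorm x

theorem opNorm_le {X : Matrix (Fin n₁) (Fin n₂) ℝ} {c : ℝ} (hc : 0 ≤ c)
    (h : ∀ x, ‖Matrix.toEuclideanLin X x‖ ≤ c * ‖x‖) : opNorm X ≤ c :=
  ContinuousLinearMap.opNorm_le_bound _ hc h

theorem singularValue_nonneg (X : Matrix (Fin n₁) (Fin n₂) ℝ) (i : ℕ) : 0 ≤ singularValue X i :=
  LinearMap.singularValues_nonneg _ _

theorem singularValue_antitone (X : Matrix (Fin n₁) (Fin n₂) ℝ) : Antitone (singularValue X) :=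
  LinearMap.singularValues_antitone _

theorem singularValue_eq_zero (X : Matrix (Fin n₁) (Fin n₂) ℝ) {i : ℕ} (hi : min n₁ n₂ ≤ i) :
    singularValue X i = 0 := by
  rw [singularValue, LinearMap.singularValues_eq_zero_iff_le_finrank_range]
  refine le_trans (le_min ?_ ?_) hi
  · exact (Submodule.finrank_le _).trans (by simp)
  · exact (LinearMap.finrank_range_le _).trans (by simp)

/-- An orthonormal basis of right singular vectors. -/
def IsSingularBasis (X : Matrix (Fin n₁) (Fin n₂) ℝ)
    (v : OrthonormalBasis (Fin n₂) ℝ (EuclideanSpace ℝ (Fin n₂))) : Prop :=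
  ∀ i j, ⟪Matrix.toEuclideanLin X (v i), Matrix.toEuclideanLin X (v j)⟫_ℝ =
    if i = j then singularValue X i ^ 2 else 0

/-- An eigenbasis of `XᵀX`. -/
theorem exists_isSingularBasis (X : Matrix (Fin n₁) (Fin n₂) ℝ) : ∃ v, IsSingularBasis X v := by
  have hn : Module.finrank ℝ (EuclideanSpace ℝ (Fin n₂)) = n₂ := by simp
  have hs := (Matrix.toEuclideanLin X).isSymmetric_adjoint_comp_self
  refine ⟨hs.eigenvectorBasis hn, fun i j => ?_⟩
  rw [← LinearMap.adjoint_inner_right, ← LinearMap.comp_apply, hs.apply_eigenvectorBasis,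
    inner_smul_right, OrthonormalBasis.inner_eq_ite, singularValue,
    LinearMap.sq_singularValues_fin _ hn]
  split_ifs with h
  · subst h; simp
  · simp

namespace IsSingularBasis

variable {X : Matrix (Fin n₁) (Fin n₂) ℝ}
  {v : OrthonormalBasis (Fin n₂) ℝ (EuclideanSpace ℝ (Fin n₂))}

theorem norm_apply (h : IsSingularBasis X v) (i : Fin n₂) :
    ‖Matrix.toEuclideanLin X (v i)‖ = singularValue X i := by
  rw [← sq_eq_sq₀ (norm_nonneg _) (singularValue_nonneg _ _), ← real_inner_self_eq_norm_sq, h i i]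
  simp

end IsSingularBasis

/-- The matrix `∑ i, w i • (X v_i) v_iᵀ`. -/
noncomputable def reweight (X : Matrix (Fin n₁) (Fin n₂) ℝ)
    (v : OrthonormalBasis (Fin n₂) ℝ (EuclideanSpace ℝ (Fin n₂))) (w : Fin n₂ → ℝ) :
    Matrix (Fin n₁) (Fin n₂) ℝ :=
  Matrix.toEuclideanLin.symm
    (v.toBasis.constr ℝ fun i => w i • Matrix.toEuclideanLin X (v i))

theorem reweight_apply_basis (X : Matrix (Fin n₁) (Fin n₂) ℝ)
    (v : OrthonormalBasis (Fin n₂) ℝ (EuclideanSpace ℝ (Fin n₂))) (w : Fin n₂ → ℝ) (i : Fin n₂) :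
    Matrix.toEuclideanLin (reweight X v w) (v i) = w i • Matrix.toEuclideanLin X (v i) := by
  rw [reweight, LinearEquiv.apply_symm_apply, ← v.coe_toBasis, Module.Basis.constr_basis]

theorem ext_of_basis {X Y : Matrix (Fin n₁) (Fin n₂) ℝ}
    (v : OrthonormalBasis (Fin n₂) ℝ (EuclideanSpace ℝ (Fin n₂)))
    (h : ∀ i, Matrix.toEuclideanLin X (v i) = Matrix.toEuclideanLin Y (v i)) : X = Y := by
  apply Matrix.toEuclideanLin.injective
  apply v.toBasis.ext
  simpa using h

theorem reweight_add (X : Matrix (Fin n₁) (Fin n₂) ℝ)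
    (v : OrthonormalBasis (Fin n₂) ℝ (EuclideanSpace ℝ (Fin n₂))) (w w' : Fin n₂ → ℝ) :
    reweight X v w + reweight X v w' = reweight X v (w + w') :=
  ext_of_basis v fun i => by simp [reweight_apply_basis, add_smul]

theorem reweight_one (X : Matrix (Fin n₁) (Fin n₂) ℝ)
    (v : OrthonormalBasis (Fin n₂) ℝ (EuclideanSpace ℝ (Fin n₂))) : reweight X v 1 = X :=
  ext_of_basis v fun i => by simp [reweight_apply_basis]

theorem reweight_apply (X : Matrix (Fin n₁) (Fin n₂) ℝ)
    (v : OrthonormalBasis (Fin n₂) ℝ (EuclideanSpace ℝ (Fin n₂))) (w : Fin n₂ → ℝ) (x) :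
    Matrix.toEuclideanLin (reweight X v w) x =
      ∑ i, (w i * ⟪v i, x⟫_ℝ) • Matrix.toEuclideanLin X (v i) := by
  conv_lhs => rw [← v.sum_repr' x]
  simp [reweight_apply_basis, smul_smul, mul_comm]

namespace IsSingularBasis

variable {X : Matrix (Fin n₁) (Fin n₂) ℝ}
  {v : OrthonormalBasis (Fin n₂) ℝ (EuclideanSpace ℝ (Fin n₂))}

theorem norm_sq_sum (h : IsSingularBasis X v) (a : Fin n₂ → ℝ) :
    ‖∑ i, a i • Matrix.toEuclideanLin X (v i)‖ ^ 2 = ∑ i, (a i * singularValue X i) ^ 2 := by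
  rw [← real_inner_self_eq_norm_sq, sum_inner]
  refine Finset.sum_congr rfl fun i _ => ?_
  rw [inner_sum, Finset.sum_eq_single i]
  · rw [inner_smul_left, inner_smul_right, h i i]; simp; ring
  · intro j _ hj
    rw [inner_smul_left, inner_smul_right, h i j, if_neg hj.symm]; simp
  · simp

theorem opNorm_reweight_le (h : IsSingularBasis X v) {w : Fin n₂ → ℝ} {c : ℝ} (hc : 0 ≤ c)
    (hw : ∀ i, |w i * singularValue X i| ≤ c) : opNorm (reweight X v w) ≤ c := by
  refine opNorm_le hc fun x => ?_
  rw [← sq_le_sq₀ (norm_nonneg _) (by positivity), reweight_apply, h.norm_sq_sum, mul_pow,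
    ← v.sum_sq_inner_right x, Finset.mul_sum]
  refine Finset.sum_le_sum fun i _ => ?_
  have : (w i * singularValue X i) ^ 2 ≤ c ^ 2 := sq_le_sq.2 (by rw [abs_of_nonneg hc]; exact hw i)
  calc _ = (w i * singularValue X i) ^ 2 * ⟪v i, x⟫_ℝ ^ 2 := by ring
    _ ≤ _ := by gcongr

theorem frobeniusNorm_reweight_sq (h : IsSingularBasis X v) (w : Fin n₂ → ℝ) :
    frobeniusNorm (reweight X v w) ^ 2 = ∑ i : Fin n₂, (w i * singularValue X i) ^ 2 := by
  rw [frobeniusNorm_sq_eq_sum _ v]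
  refine Finset.sum_congr rfl fun i _ => ?_
  rw [reweight_apply_basis, norm_smul, h.norm_apply, mul_pow, mul_pow, Real.norm_eq_abs, sq_abs]

end IsSingularBasis

theorem sum_range_max_eq (f : ℕ → ℝ) (hf : ∀ i, n₂ ≤ i → f i = 0) :
    ∑ i ∈ Finset.range (max n₁ n₂), f i = ∑ i : Fin n₂, f i := by
  rw [Fin.sum_univ_eq_sum_range f n₂]
  exact (Finset.sum_subset (Finset.range_mono (le_max_right _ _)) fun i _ hi =>
    hf i (by simpa using hi)).symm

theorem nuclearNorm_eq_sum (X : Matrix (Fin n₁) (Fin n₂) ℝ) :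
    nuclearNorm X = ∑ i : Fin n₂, singularValue X i :=
  sum_range_max_eq _ fun _ hi => singularValue_eq_zero X ((min_le_right _ _).trans hi)

theorem nuclearNorm_nonneg (X : Matrix (Fin n₁) (Fin n₂) ℝ) : 0 ≤ nuclearNorm X :=
  Finset.sum_nonneg fun _ _ => singularValue_nonneg _ _

/-- Duality of the nuclear norm and the operator norm. -/
theorem frobeniusInner_le_nuclearNorm (X Y : Matrix (Fin n₁) (Fin n₂) ℝ) :
    frobeniusInner X Y ≤ opNorm Y * nuclearNorm X := by
  obtain ⟨v, hv⟩ := exists_isSingularBasis X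
  rw [frobeniusInner_eq_sum X Y v, nuclearNorm_eq_sum, Finset.mul_sum]
  refine Finset.sum_le_sum fun i _ => (real_inner_le_norm _ _).trans ?_
  rw [hv.norm_apply, mul_comm]
  have := norm_toEuclideanLin_le Y (v i)
  rw [v.norm_eq_one, mul_one] at this
  exact mul_le_mul_of_nonneg_right this (singularValue_nonneg _ _)

/-- The certificate is the polar factor of `X`; the convention `0⁻¹ = 0` makes it vanish on the
kernel. -/
theorem exists_dual_certificate (X : Matrix (Fin n₁) (Fin n₂) ℝ) :
    ∃ Y, opNorm Y ≤ 1 ∧ frobeniusInner X Y = nuclearNorm X := by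
  obtain ⟨v, hv⟩ := exists_isSingularBasis X
  refine ⟨reweight X v fun i => (singularValue X i)⁻¹, hv.opNorm_reweight_le zero_le_one ?_, ?_⟩
  · intro i
    by_cases h : singularValue X i = 0
    · simp [h]
    · simp [h]
  · rw [frobeniusInner_eq_sum _ _ v, nuclearNorm_eq_sum]
    refine Finset.sum_congr rfl fun i _ => ?_
    rw [reweight_apply_basis, inner_smul_right, hv i i, if_pos rfl]
    by_cases h : singularValue X i = 0
    · simp [h]
    · field_simp

theorem nuclearNorm_le_of_forall {X : Matrix (Fin n₁) (Fin n₂) ℝ} {c : ℝ}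
    (h : ∀ Y, opNorm Y ≤ 1 → frobeniusInner X Y ≤ c) : nuclearNorm X ≤ c := by
  obtain ⟨Y, hY, e⟩ := exists_dual_certificate X
  exact e ▸ h Y hY

theorem frobeniusInner_le_nuclearNorm_of_le {X Y : Matrix (Fin n₁) (Fin n₂) ℝ}
    (hY : opNorm Y ≤ 1) : frobeniusInner X Y ≤ nuclearNorm X :=
  (frobeniusInner_le_nuclearNorm X Y).trans
    (mul_le_of_le_one_left (nuclearNorm_nonneg X) hY)

theorem nuclearNorm_add_le (X Y : Matrix (Fin n₁) (Fin n₂) ℝ) :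
    nuclearNorm (X + Y) ≤ nuclearNorm X + nuclearNorm Y :=
  nuclearNorm_le_of_forall fun Z hZ => by
    rw [frobeniusInner_add_left]
    exact add_le_add (frobeniusInner_le_nuclearNorm_of_le hZ)
      (frobeniusInner_le_nuclearNorm_of_le hZ)

theorem nuclearNorm_neg_le (X : Matrix (Fin n₁) (Fin n₂) ℝ) : nuclearNorm (-X) ≤ nuclearNorm X :=
  nuclearNorm_le_of_forall fun Z hZ => by
    have h : opNorm (-Z) ≤ 1 := by simpa [opNorm] using hZ
    have := frobeniusInner_le_nuclearNorm_of_le (X := X) h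
    rw [frobeniusInner_comm, frobeniusInner_neg_left, frobeniusInner_comm] at this
    rwa [frobeniusInner_neg_left]

theorem nuclearNorm_sub_le (X Y : Matrix (Fin n₁) (Fin n₂) ℝ) :
    nuclearNorm (X - Y) ≤ nuclearNorm X + nuclearNorm Y := by
  rw [sub_eq_add_neg]
  exact (nuclearNorm_add_le _ _).trans (by linarith [nuclearNorm_neg_le Y])

/-- Cauchy–Schwarz over the at most `k` nonzero singular values. -/
theorem nuclearNorm_le_of_finrank_le (X : Matrix (Fin n₁) (Fin n₂) ℝ) {k : ℕ}
    (hk : Module.finrank ℝ (LinearMap.range (Matrix.toEuclideanLin X)) ≤ k) :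
    nuclearNorm X ≤ √k * frobeniusNorm X := by
  obtain ⟨v, hv⟩ := exists_isSingularBasis X
  have h0 : ∀ i, k ≤ i → singularValue X i = 0 := fun i hi => by
    rw [singularValue, LinearMap.singularValues_eq_zero_iff_le_finrank_range]
    exact hk.trans hi
  have hF : frobeniusNorm X ^ 2 = ∑ i ∈ Finset.range (max n₁ n₂), singularValue X i ^ 2 := by
    rw [← reweight_one X v, hv.frobeniusNorm_reweight_sq, reweight_one,
      sum_range_max_eq fun i => singularValue X i ^ 2]
    · simp
    · intro i hi
      rw [singularValue_eq_zero X ((min_le_right _ _).trans hi)]; simp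
  have e1 : nuclearNorm X = ∑ i ∈ Finset.range (min (max n₁ n₂) k), singularValue X i := by
    refine (Finset.sum_subset (Finset.range_mono (min_le_left _ _)) fun i hi hi' => ?_).symm
    simp only [Finset.mem_range] at hi hi'
    exact h0 i (by omega)
  have e2 : ∑ i ∈ Finset.range (min (max n₁ n₂) k), singularValue X i ^ 2 ≤
      frobeniusNorm X ^ 2 := by
    rw [hF]
    exact Finset.sum_le_sum_of_subset_of_nonneg (Finset.range_mono (min_le_left _ _))
      fun _ _ _ => by positivity
  rw [← sq_le_sq₀ (nuclearNorm_nonneg _) (mul_nonneg (Real.sqrt_nonneg _) (frobeniusNorm_nonneg _)),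
    mul_pow, Real.sq_sqrt (by positivity), e1]
  refine sq_sum_le_card_mul_sum_sq.trans ?_
  rw [Finset.card_range]
  gcongr
  exact min_le_right _ _

theorem nuclearNorm_le_frobeniusNorm (X : Matrix (Fin n₁) (Fin n₂) ℝ) :
    nuclearNorm X ≤ √(min n₁ n₂ : ℕ) * frobeniusNorm X :=
  nuclearNorm_le_of_finrank_le X <| le_min ((Submodule.finrank_le _).trans (by simp))
    ((LinearMap.finrank_range_le _).trans (by simp))

/-- The matrix of `T ∘ X`. -/
noncomputable def postcomp (T : EuclideanSpace ℝ (Fin n₁) →ₗ[ℝ] EuclideanSpace ℝ (Fin n₁))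
    (X : Matrix (Fin n₁) (Fin n₂) ℝ) : Matrix (Fin n₁) (Fin n₂) ℝ :=
  Matrix.toEuclideanLin.symm (T ∘ₗ Matrix.toEuclideanLin X)

theorem toEuclideanLin_postcomp (T : EuclideanSpace ℝ (Fin n₁) →ₗ[ℝ] EuclideanSpace ℝ (Fin n₁))
    (X : Matrix (Fin n₁) (Fin n₂) ℝ) :
    Matrix.toEuclideanLin (postcomp T X) = T ∘ₗ Matrix.toEuclideanLin X := by
  rw [postcomp, LinearEquiv.apply_symm_apply]

theorem frobeniusNorm_le_of_basis {X Y : Matrix (Fin n₁) (Fin n₂) ℝ}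
    (v : OrthonormalBasis (Fin n₂) ℝ (EuclideanSpace ℝ (Fin n₂)))
    (h : ∀ i, ‖Matrix.toEuclideanLin X (v i)‖ ≤ ‖Matrix.toEuclideanLin Y (v i)‖) :
    frobeniusNorm X ≤ frobeniusNorm Y := by
  rw [← sq_le_sq₀ (frobeniusNorm_nonneg _) (frobeniusNorm_nonneg _), frobeniusNorm_sq_eq_sum X v,
    frobeniusNorm_sq_eq_sum Y v]
  exact Finset.sum_le_sum fun i _ => by gcongr; exact h i

set_option maxHeartbeats 800000 in
/-- The nuclear norm is almost additive at a matrix of rank at most `#I`. -/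
theorem nuclearNorm_add_nuclearNorm_le {X : Matrix (Fin n₁) (Fin n₂) ℝ}
    {v : OrthonormalBasis (Fin n₂) ℝ (EuclideanSpace ℝ (Fin n₂))} (hv : IsSingularBasis X v)
    (I : Finset (Fin n₂)) (E : Matrix (Fin n₁) (Fin n₂) ℝ) :
    nuclearNorm (reweight X v fun i => if i ∈ I then 1 else 0) + nuclearNorm E ≤
      nuclearNorm ((reweight X v fun i => if i ∈ I then 1 else 0) + E)
        + 3 * √(I.card) * frobeniusNorm E := by
  classical
  set M₀ := reweight X v fun i => if i ∈ I then 1 else 0 with hM₀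
  -- `S` is the column space of `M₀`. Compressing `E` to `Sᗮ` on the left and to the span of the `v
  -- i`, `i ∉ I`, on the right gives `Ec`; the remainder is a sum of two matrices of rank at most
  -- `I.card`, which costs `2 √I.card ‖E‖_F` in nuclear norm.
  let S : Submodule ℝ (EuclideanSpace ℝ (Fin n₁)) :=
    Submodule.span ℝ (I.image fun i => Matrix.toEuclideanLin X (v i) : Finset _)
  have hSdim : Module.finrank ℝ S ≤ I.card :=
    (finrank_span_finset_le_card _).trans Finset.card_image_le
  let T : EuclideanSpace ℝ (Fin n₁) →ₗ[ℝ] EuclideanSpace ℝ (Fin n₁) := S.starProjection.toLinearMap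
  let T' : EuclideanSpace ℝ (Fin n₁) →ₗ[ℝ] EuclideanSpace ℝ (Fin n₁) :=
    Sᗮ.starProjection.toLinearMap
  have hTT' : ∀ x, T x + T' x = x := fun x => S.starProjection_add_starProjection_orthogonal x
  have hT' : ∀ x y, ⟪x, T' y⟫_ℝ = ⟪T' x, y⟫_ℝ := fun x y =>
    (Sᗮ.inner_starProjection_left_eq_right x y).symm
  have hTn : ∀ x, ‖T x‖ ≤ ‖x‖ := fun x => S.norm_starProjection_apply_le x
  have hTn' : ∀ x, ‖T' x‖ ≤ ‖x‖ := fun x => Sᗮ.norm_starProjection_apply_le x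
  let w : Fin n₂ → ℝ := fun i => if i ∈ I then 1 else 0
  let w' : Fin n₂ → ℝ := fun i => if i ∈ I then 0 else 1
  have hww' : w + w' = 1 := by
    ext i; by_cases h : i ∈ I <;> simp [w, w', h]
  have hcard : ∑ i, w i = I.card := by simp [w]
  -- the part of `E` that does not interact with `M₀`
  set Ec := postcomp T' (reweight E v w') with hEc
  have hdec : E = Ec + (postcomp T E + postcomp T' (reweight E v w)) := by
    refine ext_of_basis v fun i => ?_
    simp only [map_add, LinearMap.add_apply, hEc, toEuclideanLin_postcomp, LinearMap.comp_apply,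
      reweight_apply_basis, map_smul]
    conv_lhs => rw [← hTT' (Matrix.toEuclideanLin E (v i))]
    by_cases h : i ∈ I
    · simp only [w, w', h, if_true, one_smul, zero_smul, zero_add]
    · simp only [w, w', h, if_false, one_smul, zero_smul, add_zero]
      exact add_comm _ _
  have hrank₁ : nuclearNorm (postcomp T E) ≤ √I.card * frobeniusNorm E := by
    refine (nuclearNorm_le_of_finrank_le _ (k := I.card) ?_).trans ?_
    · rw [toEuclideanLin_postcomp]
      refine (Submodule.finrank_mono ?_).trans hSdim
      rintro _ ⟨x, rfl⟩
      exact S.starProjection_apply_mem _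
    · refine mul_le_mul_of_nonneg_left ?_ (Real.sqrt_nonneg _)
      exact frobeniusNorm_le_of_basis v fun i => by
        rw [toEuclideanLin_postcomp]; exact hTn _
  have hrank₂ : nuclearNorm (postcomp T' (reweight E v w)) ≤ √I.card * frobeniusNorm E := by
    refine (nuclearNorm_le_of_finrank_le _ (k := I.card) ?_).trans ?_
    · have hle : LinearMap.range (Matrix.toEuclideanLin (postcomp T' (reweight E v w))) ≤
          Submodule.span ℝ
            (I.image fun i => T' (Matrix.toEuclideanLin E (v i)) : Finset _) := by
        rintro _ ⟨x, rfl⟩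
        rw [toEuclideanLin_postcomp, LinearMap.comp_apply, reweight_apply, map_sum]
        refine Submodule.sum_mem _ fun i _ => ?_
        by_cases h : i ∈ I
        · rw [map_smul]
          refine Submodule.smul_mem _ _ (Submodule.subset_span ?_)
          exact Finset.mem_coe.2 (Finset.mem_image_of_mem _ h)
        · simp [w, h]
      exact (Submodule.finrank_mono hle).trans
        ((finrank_span_finset_le_card _).trans Finset.card_image_le)
    · refine mul_le_mul_of_nonneg_left ?_ (Real.sqrt_nonneg _)
      refine frobeniusNorm_le_of_basis v fun i => ?_
      rw [toEuclideanLin_postcomp, LinearMap.comp_apply, reweight_apply_basis]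
      refine (hTn' _).trans ?_
      rw [norm_smul]
      refine mul_le_of_le_one_left (norm_nonneg _) ?_
      by_cases h : i ∈ I <;> simp [w, h]
  have hE : nuclearNorm E ≤ nuclearNorm Ec + 2 * √I.card * frobeniusNorm E := by
    calc nuclearNorm E = nuclearNorm (Ec + (postcomp T E + postcomp T' (reweight E v w))) := by
          rw [← hdec]
      _ ≤ nuclearNorm Ec + (nuclearNorm (postcomp T E) +
            nuclearNorm (postcomp T' (reweight E v w))) :=
          (nuclearNorm_add_le _ _).trans (by gcongr; exact nuclearNorm_add_le _ _)
      _ ≤ _ := by linarith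
  -- the dual certificate
  obtain ⟨Y, hY, hYe⟩ := exists_dual_certificate Ec
  set Y₀ := reweight X v fun i => w i * (singularValue X i)⁻¹ with hY₀
  set Yc := postcomp T' (reweight Y v w') with hYc
  -- `Y₀` and `Yc` have orthogonal ranges and act on complementary basis vectors, so their sum is
  -- still a contraction.
  have hop : opNorm (Y₀ + Yc) ≤ 1 := by
    refine opNorm_le zero_le_one fun x => ?_
    have hx0 : Matrix.toEuclideanLin Y₀ x ∈ S := by
      rw [hY₀, reweight_apply]
      refine Submodule.sum_mem _ fun i _ => ?_
      by_cases h : i ∈ I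
      · refine Submodule.smul_mem _ _ (Submodule.subset_span ?_)
        exact Finset.mem_coe.2 (Finset.mem_image_of_mem _ h)
      · simp [w, h]
    have hxc : Matrix.toEuclideanLin Yc x ∈ Sᗮ := by
      rw [hYc, toEuclideanLin_postcomp]
      exact Sᗮ.starProjection_apply_mem _
    have hort : ⟪Matrix.toEuclideanLin Y₀ x, Matrix.toEuclideanLin Yc x⟫_ℝ = 0 :=
      Submodule.inner_right_of_mem_orthogonal hx0 hxc
    have h0 : ‖Matrix.toEuclideanLin Y₀ x‖ ^ 2 ≤ ∑ i, w i * ⟪v i, x⟫_ℝ ^ 2 := by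
      rw [hY₀, reweight_apply, hv.norm_sq_sum]
      refine Finset.sum_le_sum fun i _ => ?_
      by_cases h : i ∈ I
      · by_cases h1 : singularValue X i = 0
        · simp [w, h, h1]; positivity
        · simp only [w, h, if_true]
          field_simp
          simp
      · simp [w, h]
    have hc : ‖Matrix.toEuclideanLin Yc x‖ ^ 2 ≤ ∑ i, w' i * ⟪v i, x⟫_ℝ ^ 2 := by
      let x' : EuclideanSpace ℝ (Fin n₂) := ∑ i, (w' i * ⟪v i, x⟫_ℝ) • v i
      have e : Matrix.toEuclideanLin (reweight Y v w') x = Matrix.toEuclideanLin Y x' := by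
        rw [reweight_apply]; simp [x']
      have hx' : ‖x'‖ ^ 2 = ∑ i, w' i * ⟪v i, x⟫_ℝ ^ 2 := by
        rw [← v.sum_sq_inner_right x']
        refine Finset.sum_congr rfl fun i _ => ?_
        have : ⟪v i, x'⟫_ℝ = w' i * ⟪v i, x⟫_ℝ := by
          simp [x', inner_sum, inner_smul_right, OrthonormalBasis.inner_eq_ite]
        rw [this]
        by_cases h : i ∈ I <;> simp [w', h]
      rw [← hx', hYc, toEuclideanLin_postcomp, LinearMap.comp_apply, e]
      gcongr
      refine (hTn' _).trans ((norm_toEuclideanLin_le Y x').trans ?_)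
      exact mul_le_of_le_one_left (norm_nonneg _) hY
    rw [one_mul, ← sq_le_sq₀ (norm_nonneg _) (norm_nonneg _), map_add, LinearMap.add_apply,
      norm_add_sq_real, hort, ← v.sum_sq_inner_right x]
    have : ∑ i, ⟪v i, x⟫_ℝ ^ 2 = ∑ i, w i * ⟪v i, x⟫_ℝ ^ 2 + ∑ i, w' i * ⟪v i, x⟫_ℝ ^ 2 := by
      rw [← Finset.sum_add_distrib]
      refine Finset.sum_congr rfl fun i _ => ?_
      rw [← add_mul, ← Pi.add_apply, hww', Pi.one_apply, one_mul]
    linarith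
  have hcert := frobeniusInner_le_nuclearNorm_of_le (X := M₀ + E) hop
  rw [frobeniusInner_add_left, frobeniusInner_add_right, frobeniusInner_add_right] at hcert
  have t1 : nuclearNorm M₀ ≤ frobeniusInner M₀ Y₀ := by
    refine nuclearNorm_le_of_forall fun Z hZ => ?_
    rw [frobeniusInner_eq_sum _ _ v, frobeniusInner_eq_sum _ _ v]
    refine Finset.sum_le_sum fun i _ => ?_
    rw [hM₀, hY₀, reweight_apply_basis, reweight_apply_basis]
    by_cases h : i ∈ I
    · simp only [w, h, if_true, one_smul, one_mul]
      rw [inner_smul_right, hv i i, if_pos rfl]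
      have hz := norm_toEuclideanLin_le Z (v i)
      rw [v.norm_eq_one, mul_one] at hz
      have := (real_inner_le_norm (Matrix.toEuclideanLin X (v i))
        (Matrix.toEuclideanLin Z (v i))).trans
        (mul_le_of_le_one_right (norm_nonneg _) (hz.trans hZ))
      rw [hv.norm_apply] at this
      refine this.trans_eq ?_
      by_cases h1 : singularValue X i = 0
      · simp [h1]
      · field_simp
    · simp [w, h]
  have t2 : frobeniusInner M₀ Yc = 0 := by
    rw [frobeniusInner_eq_sum _ _ v]
    refine Finset.sum_eq_zero fun i _ => ?_
    rw [hM₀, hYc, toEuclideanLin_postcomp, LinearMap.comp_apply, reweight_apply_basis,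
      reweight_apply_basis]
    by_cases h : i ∈ I <;> simp [w', h]
  -- The third `√I.card ‖E‖_F`: the certificate `Y₀` of `M₀` also meets `E`, and `‖Y₀‖_F ≤ √I.card`.
  have t3 : -(√I.card * frobeniusNorm E) ≤ frobeniusInner E Y₀ := by
    have hF : frobeniusNorm Y₀ ≤ √I.card := by
      refine Real.le_sqrt_of_sq_le ?_
      rw [hY₀, hv.frobeniusNorm_reweight_sq, ← hcard]
      refine Finset.sum_le_sum fun i _ => ?_
      by_cases h : i ∈ I
      · by_cases h1 : singularValue X i = 0 <;> simp [w, h, h1]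
      · simp [w, h]
    have := frobeniusInner_le (-E) Y₀
    rw [frobeniusInner_neg_left] at this
    have hn : frobeniusNorm (-E) = frobeniusNorm E := by rw [← norm_vec, map_neg, norm_neg, norm_vec]
    rw [hn] at this
    have := mul_le_mul_of_nonneg_left hF (frobeniusNorm_nonneg E)
    linarith
  have t4 : frobeniusInner E Yc = nuclearNorm Ec := by
    rw [← hYe, frobeniusInner_eq_sum _ _ v, frobeniusInner_eq_sum _ _ v]
    refine Finset.sum_congr rfl fun i _ => ?_
    rw [hYc, hEc, toEuclideanLin_postcomp, toEuclideanLin_postcomp, LinearMap.comp_apply,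
      LinearMap.comp_apply, reweight_apply_basis, reweight_apply_basis, hT', map_smul,
      inner_smul_left, inner_smul_right]
    rfl
  linarith

end SingularBasis

/-! ### Restricted isometry on low-rank matrices -/

section RestrictedIsometry

open scoped InnerProductSpace

variable {n₁ n₂ m : ℕ}

/-- The measurement map with values in Euclidean space. -/
def measurementVec (A : Fin m → Matrix (Fin n₁) (Fin n₂) ℝ) :
    Matrix (Fin n₁) (Fin n₂) ℝ →ₗ[ℝ] EuclideanSpace ℝ (Fin m) where
  toFun X := WithLp.toLp 2 (measurementMap A X)
  map_add' X Y := by rw [measurementMap_add]; rfl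
  map_smul' c X := by rw [measurementMap_smul]; rfl

theorem norm_measurementVec_sq (A : Fin m → Matrix (Fin n₁) (Fin n₂) ℝ)
    (X : Matrix (Fin n₁) (Fin n₂) ℝ) :
    ‖measurementVec A X‖ ^ 2 = ∑ i, measurementMap A X i ^ 2 :=
  EuclideanSpace.real_norm_sq_eq _

/-- The product of an `n₁ × R` matrix and an `R × n₂` matrix, as a bilinear map. -/
def productMatrix (n₁ n₂ R : ℕ) : (EuclideanSpace ℝ (Fin R) →L[ℝ] EuclideanSpace ℝ (Fin n₁)) →ₗ[ℝ]
    (PiLp 2 fun _ : Fin n₂ => EuclideanSpace ℝ (Fin R)) →ₗ[ℝ] Matrix (Fin n₁) (Fin n₂) ℝ :=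
  LinearMap.mk₂ ℝ (fun U V => Matrix.of fun j k => U (V k) j)
    (fun _ _ _ => by ext; simp) (fun _ _ _ => by ext; simp)
    (fun _ _ _ => by ext; simp) (fun _ _ _ => by ext; simp)

theorem productMatrix_apply {R : ℕ}
    (U : EuclideanSpace ℝ (Fin R) →L[ℝ] EuclideanSpace ℝ (Fin n₁))
    (V : PiLp 2 fun _ : Fin n₂ => EuclideanSpace ℝ (Fin R)) (j : Fin n₁) (k : Fin n₂) :
    productMatrix n₁ n₂ R U V j k = U (V k) j := rfl

theorem frobeniusNorm_productMatrix_le {R : ℕ}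
    (U : EuclideanSpace ℝ (Fin R) →L[ℝ] EuclideanSpace ℝ (Fin n₁))
    (V : PiLp 2 fun _ : Fin n₂ => EuclideanSpace ℝ (Fin R)) :
    frobeniusNorm (productMatrix n₁ n₂ R U V) ≤ ‖U‖ * ‖V‖ := by
  rw [← sq_le_sq₀ (frobeniusNorm_nonneg _) (by positivity), frobeniusNorm_sq, mul_pow,
    PiLp.norm_sq_eq_of_L2, Finset.sum_comm, Finset.mul_sum]
  refine Finset.sum_le_sum fun k _ => ?_
  have h : ∑ j, productMatrix n₁ n₂ R U V j k ^ 2 = ‖U (V k)‖ ^ 2 :=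
    (EuclideanSpace.real_norm_sq_eq _).symm
  rw [h, ← mul_pow]
  gcongr
  exact U.le_opNorm _

/-- The measurement map nearly preserves the Frobenius norm of matrices of rank at most `R`. -/
def IsRestrictedIsometry (A : Fin m → Matrix (Fin n₁) (Fin n₂) ℝ) (R : ℕ) : Prop :=
  ∀ U V, ‖U‖ ≤ 1 → ‖V‖ ≤ 1 → frobeniusNorm (productMatrix n₁ n₂ R U V) = 1 →
    1 / 4 ≤ ‖measurementVec A (productMatrix n₁ n₂ R U V)‖ ∧
    ‖measurementVec A (productMatrix n₁ n₂ R U V)‖ ≤ 16 / 7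

/-- Union bound over nets of the two factors, `U` in operator norm and `V` in Frobenius norm. Only
`R (n₁ + n₂)` dimensions enter, and the bilinear net lemma passes to all products. -/
theorem prob_not_isRestrictedIsometry_le {Ω : Type*} [MeasurableSpace Ω] {P : Measure Ω}
    [IsProbabilityMeasure P] {A : Ω → Fin m → Matrix (Fin n₁) (Fin n₂) ℝ} {z : Ω → Fin m → ℝ}
    {σ : ℝ≥0} (hA : IsGaussianEnsemble P A) (hz : IsGaussianNoise P σ z)
    (hAz : IndepFun (fun (ω : Ω) (p : Fin m × Fin n₁ × Fin n₂) => A ω p.1 p.2.1 p.2.2) z P)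
    (hm : 0 < m) (R : ℕ) :
    P.real {ω | ¬ IsRestrictedIsometry (A ω) R} ≤
      33 ^ (R * (n₁ + n₂)) * (2 * Real.exp (-(1 / 16 * m))) := by
  obtain ⟨s, hs, hs', hsc⟩ :=
    exists_net (EuclideanSpace ℝ (Fin R) →L[ℝ] EuclideanSpace ℝ (Fin n₁))
  obtain ⟨t, ht, ht', htc⟩ := exists_net (PiLp 2 fun _ : Fin n₂ => EuclideanSpace ℝ (Fin R))
  have hfs : Module.finrank ℝ (EuclideanSpace ℝ (Fin R) →L[ℝ] EuclideanSpace ℝ (Fin n₁)) =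
      R * n₁ := by
    rw [← LinearMap.toContinuousLinearMap.finrank_eq, Module.finrank_linearMap]
    simp
  have hft : Module.finrank ℝ (PiLp 2 fun _ : Fin n₂ => EuclideanSpace ℝ (Fin R)) = R * n₂ := by
    rw [(WithLp.linearEquiv 2 ℝ (Fin n₂ → EuclideanSpace ℝ (Fin R))).finrank_eq]
    simp [Module.finrank_pi_fintype, mul_comm]
  let bad : (EuclideanSpace ℝ (Fin R) →L[ℝ] EuclideanSpace ℝ (Fin n₁)) ×
      (PiLp 2 fun _ : Fin n₂ => EuclideanSpace ℝ (Fin R)) → Set Ω := fun p =>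
    {ω | ¬ (49 / 100 * frobeniusNorm (productMatrix n₁ n₂ R p.1 p.2) ^ 2 ≤
        ∑ i, measurementMap (A ω) (productMatrix n₁ n₂ R p.1 p.2) i ^ 2 ∧
      ∑ i, measurementMap (A ω) (productMatrix n₁ n₂ R p.1 p.2) i ^ 2 ≤
        4 * frobeniusNorm (productMatrix n₁ n₂ R p.1 p.2) ^ 2)}
  have hsub : {ω | ¬ IsRestrictedIsometry (A ω) R} ⊆ ⋃ p ∈ s ×ˢ t, bad p := by
    intro ω hω
    by_contra hcon
    simp only [Set.mem_iUnion, not_exists, bad, Set.mem_ofPred_eq, not_not] at hcon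
    apply hω
    obtain ⟨h1, h2⟩ := norm_comp_bilinear_ge_of_net (productMatrix n₁ n₂ R) (measurementVec (A ω))
      vec hs hs' ht ht'
      (fun U V => by rw [norm_vec]; exact frobeniusNorm_productMatrix_le U V) (c := 1)
      (fun p hp q hq => by
        have := hcon (p, q) (Finset.mem_product.2 ⟨hp, hq⟩)
        rw [← norm_measurementVec_sq] at this
        rw [norm_vec, mul_one, mul_one]
        have h0 := frobeniusNorm_nonneg (productMatrix n₁ n₂ R p q)
        constructor
        · rw [← sq_le_sq₀ (by positivity) (norm_nonneg _), mul_pow]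
          refine le_trans (le_of_eq ?_) this.1
          norm_num
        · rw [← sq_le_sq₀ (norm_nonneg _) (by positivity), mul_pow]
          refine this.2.trans (le_of_eq ?_)
          norm_num) zero_le_one
    intro U V hU hV hUV
    constructor
    · simpa using h2 U V hU hV (by rw [norm_vec, hUV])
    · refine (h1 U V).trans ?_
      have : ‖U‖ * ‖V‖ ≤ 1 := mul_le_one₀ hU (norm_nonneg _) hV
      linarith
  calc P.real {ω | ¬ IsRestrictedIsometry (A ω) R} ≤ P.real (⋃ p ∈ s ×ˢ t, bad p) :=
        measureReal_mono hsub (measure_ne_top _ _)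
    _ ≤ ∑ p ∈ s ×ˢ t, P.real (bad p) := measureReal_biUnion_finset_le _ _
    _ ≤ ∑ p ∈ s ×ˢ t, 2 * Real.exp (-(1 / 16 * m)) :=
        Finset.sum_le_sum fun p _ => measurementMap_distortion hA hz hAz hm _
    _ = (s.card * t.card : ℕ) * (2 * Real.exp (-(1 / 16 * m))) := by
        rw [Finset.sum_const, Finset.card_product, nsmul_eq_mul]
    _ ≤ _ := by
        gcongr
        rw [mul_add, pow_add]
        rw [hfs] at hsc
        rw [hft] at htc
        exact_mod_cast Nat.mul_le_mul hsc htc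

/-- A truncated singular value decomposition: `U` carries the left singular vectors `X v_i / σ_i`,
`V` the rows `σ_i v_i`, and `φ` assigns the indices in `I` to distinct inner slots. -/
theorem IsSingularBasis.exists_productMatrix {X : Matrix (Fin n₁) (Fin n₂) ℝ}
    {v : OrthonormalBasis (Fin n₂) ℝ (EuclideanSpace ℝ (Fin n₂))} (hv : IsSingularBasis X v)
    {R : ℕ} (hR : 0 < R) {I : Finset (Fin n₂)} (hI : I.card ≤ R) :
    ∃ U V, ‖U‖ ≤ 1 ∧ ‖V‖ = frobeniusNorm (reweight X v fun i => if i ∈ I then 1 else 0) ∧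
      productMatrix n₁ n₂ R U V = reweight X v fun i => if i ∈ I then 1 else 0 := by
  classical
  obtain ⟨φ, hφ⟩ : ∃ φ : Fin n₂ → Fin R, Set.InjOn φ I := by
    obtain ⟨e⟩ := Function.Embedding.nonempty_of_card_le (α := I) (β := Fin R) (by simpa using hI)
    -- The value of `φ` outside `I` is a dummy: those indices have weight zero.
    refine ⟨fun i => if h : i ∈ I then e ⟨i, h⟩ else ⟨0, hR⟩, fun i hi j hj hij => ?_⟩
    simp only [Finset.mem_coe] at hi hj
    simp only [hi, hj, dif_pos] at hij
    simpa using e.injective hij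
  let U : EuclideanSpace ℝ (Fin R) →L[ℝ] EuclideanSpace ℝ (Fin n₁) :=
    ∑ i, (EuclideanSpace.proj (φ i)).smulRight
      (((if i ∈ I then 1 else 0) * (singularValue X i)⁻¹) • Matrix.toEuclideanLin X (v i))
  have hU : ∀ x, U x = ∑ i, (x (φ i) * ((if i ∈ I then 1 else 0) * (singularValue X i)⁻¹)) •
      Matrix.toEuclideanLin X (v i) := by
    intro x
    simp [U, smul_smul]
  let V : PiLp 2 fun _ : Fin n₂ => EuclideanSpace ℝ (Fin R) :=
    WithLp.toLp 2 fun k => WithLp.toLp 2 fun l =>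
      ∑ i ∈ I, if φ i = l then singularValue X i * v i k else 0
  have hV : ∀ k, ∀ i ∈ I, V k (φ i) = singularValue X i * v i k := by
    intro k i hi
    change (∑ i' ∈ I, if φ i' = φ i then singularValue X i' * v i' k else 0) = _
    rw [Finset.sum_eq_single i]
    · simp
    · intro j hj hji
      rw [if_neg]
      exact fun h => hji (hφ hj hi h)
    · exact fun h => absurd hi h
  refine ⟨U, V, ?_, ?_, ?_⟩
  · refine ContinuousLinearMap.opNorm_le_bound _ zero_le_one fun x => ?_
    rw [one_mul, ← sq_le_sq₀ (norm_nonneg _) (norm_nonneg _), hU, hv.norm_sq_sum,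
      EuclideanSpace.real_norm_sq_eq]
    calc _ ≤ ∑ i, if i ∈ I then x (φ i) ^ 2 else 0 := by
          refine Finset.sum_le_sum fun i _ => ?_
          by_cases h : i ∈ I
          · by_cases h1 : singularValue X i = 0
            · simp [h, h1]; positivity
            · simp [h, h1]
          · simp [h]
      _ = ∑ i ∈ I, x (φ i) ^ 2 := by simp
      _ = ∑ l ∈ I.image φ, x l ^ 2 := (Finset.sum_image (f := fun l => x l ^ 2) hφ).symm
      _ ≤ _ := Finset.sum_le_sum_of_subset_of_nonneg (Finset.subset_univ _)
          fun _ _ _ => by positivity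
  · rw [← sq_eq_sq₀ (norm_nonneg _) (frobeniusNorm_nonneg _), hv.frobeniusNorm_reweight_sq,
      PiLp.norm_sq_eq_of_L2]
    have h1 : ∀ k, ‖V k‖ ^ 2 = ∑ i ∈ I, (singularValue X i * v i k) ^ 2 := by
      intro k
      rw [EuclideanSpace.real_norm_sq_eq]
      calc ∑ l, V k l ^ 2 = ∑ l, ∑ i ∈ I, if φ i = l then V k l * (singularValue X i * v i k)
              else 0 := by
            refine Finset.sum_congr rfl fun l _ => ?_
            have : V k l = ∑ i ∈ I, if φ i = l then singularValue X i * v i k else 0 := rfl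
            rw [sq]
            nth_rewrite 2 [this]
            simp [Finset.mul_sum]
        _ = ∑ i ∈ I, V k (φ i) * (singularValue X i * v i k) := by
            rw [Finset.sum_comm]; simp
        _ = _ := Finset.sum_congr rfl fun i hi => by rw [hV k i hi, sq]
    simp only [h1]
    rw [Finset.sum_comm]
    have h2 : ∀ i : Fin n₂, ∑ k, (singularValue X i * v i k) ^ 2 = singularValue X i ^ 2 := by
      intro i
      simp only [mul_pow, ← Finset.mul_sum]
      rw [← EuclideanSpace.real_norm_sq_eq, v.norm_eq_one]; simp
    simp [h2]
  · ext j k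
    rw [productMatrix_apply, hU]
    have h3 : reweight X v (fun i => if i ∈ I then 1 else 0) j k =
        Matrix.toEuclideanLin (reweight X v (fun i => if i ∈ I then 1 else 0))
          (EuclideanSpace.single k 1) j := by simp
    rw [h3, reweight_apply]
    refine congrArg (fun x : EuclideanSpace ℝ (Fin n₁) => x j)
      (Finset.sum_congr rfl fun i _ => ?_)
    by_cases h : i ∈ I
    · by_cases h1 : singularValue X i = 0
      · have : Matrix.toEuclideanLin X (v i) = 0 := by
          rw [← norm_eq_zero, hv.norm_apply, h1]
        simp [this]
      · rw [hV k i h]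
        congr 1
        rw [EuclideanSpace.inner_single_right]
        simp [h]
        field_simp
    · simp [h]

theorem IsRestrictedIsometry.bounds {A : Fin m → Matrix (Fin n₁) (Fin n₂) ℝ} {R : ℕ}
    (hA : IsRestrictedIsometry A R) (hR : 0 < R) {X : Matrix (Fin n₁) (Fin n₂) ℝ}
    {v : OrthonormalBasis (Fin n₂) ℝ (EuclideanSpace ℝ (Fin n₂))} (hv : IsSingularBasis X v)
    {I : Finset (Fin n₂)} (hI : I.card ≤ R) :
    1 / 4 * frobeniusNorm (reweight X v fun i => if i ∈ I then 1 else 0) ≤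
      ‖measurementVec A (reweight X v fun i => if i ∈ I then 1 else 0)‖ ∧
    ‖measurementVec A (reweight X v fun i => if i ∈ I then 1 else 0)‖ ≤
      16 / 7 * frobeniusNorm (reweight X v fun i => if i ∈ I then 1 else 0) := by
  obtain ⟨U, V, hU, hV, hUV⟩ := hv.exists_productMatrix hR hI
  set Y := reweight X v fun i => if i ∈ I then 1 else 0
  rcases (frobeniusNorm_nonneg Y).eq_or_lt with h0 | h0
  · have hY : Y = 0 := by
      rw [← norm_vec, eq_comm, norm_eq_zero] at h0
      ext j k
      exact congrArg (fun x : EuclideanSpace ℝ (Fin n₁ × Fin n₂) => x (j, k)) h0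
    have hF : frobeniusNorm (0 : Matrix (Fin n₁) (Fin n₂) ℝ) = 0 := by rw [← norm_vec]; simp
    rw [hY, hF]; simp
  · set c := frobeniusNorm Y
    have e : productMatrix n₁ n₂ R U (c⁻¹ • V) = c⁻¹ • Y := by rw [map_smul, hUV]
    have h := hA U (c⁻¹ • V) hU
      (by rw [norm_smul, hV, norm_inv, Real.norm_of_nonneg h0.le, inv_mul_cancel₀ h0.ne'])
      (by rw [e, frobeniusNorm_smul, abs_of_pos (inv_pos.2 h0)]; exact inv_mul_cancel₀ h0.ne')
    rw [e, map_smul, norm_smul, norm_inv, Real.norm_of_nonneg h0.le, inv_mul_eq_div,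
      le_div_iff₀ h0, div_le_iff₀ h0] at h
    exact h

/-- A restricted isometry is bounded below up to a multiple of the nuclear norm. -/
theorem IsRestrictedIsometry.lower_bound {A : Fin m → Matrix (Fin n₁) (Fin n₂) ℝ} {R : ℕ}
    (hA : IsRestrictedIsometry A R) (hR : 0 < R) (X : Matrix (Fin n₁) (Fin n₂) ℝ) :
    1 / 4 * frobeniusNorm X ≤ ‖measurementVec A X‖ + 3 / √R * nuclearNorm X := by
  classical
  obtain ⟨v, hv⟩ := exists_isSingularBasis X
  have hR' : (0 : ℝ) < R := by exact_mod_cast hR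
  let blk : ℕ → ℕ → Finset (Fin n₂) := fun a b => Finset.univ.filter fun i => a ≤ i ∧ (i : ℕ) < b
  let Z : ℕ → ℕ → Matrix (Fin n₁) (Fin n₂) ℝ := fun a b =>
    reweight X v fun i => if i ∈ blk a b then 1 else 0
  have hsplit : ∀ b c, b ≤ c → Z 0 c = Z 0 b + Z b c := by
    intro b c hbc
    simp only [Z]
    rw [reweight_add]
    congr 1
    ext i
    simp only [blk, Finset.mem_filter, Finset.mem_univ, true_and, Pi.add_apply, zero_le]
    by_cases h1 : (i : ℕ) < b
    · simp [h1, h1.trans_le hbc]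
    · simp [h1, not_lt.1 h1]
  have hcard : ∀ a, (blk a (a + R)).card ≤ R := by
    intro a
    calc (blk a (a + R)).card = ((blk a (a + R)).image Fin.val).card :=
          (Finset.card_image_of_injective _ Fin.val_injective).symm
      _ ≤ (Finset.Ico a (a + R)).card := by
          refine Finset.card_le_card fun i hi => ?_
          obtain ⟨j, hj, rfl⟩ := Finset.mem_image.1 hi
          simpa [blk] using hj
      _ = R := by simp
  -- Monotonicity: each singular value in a block of length `R` is at most the average over the
  -- preceding block.
  have hblock : ∀ a, frobeniusNorm (Z (a + R) (a + R + R)) ≤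
      1 / √R * ∑ l ∈ Finset.range R, singularValue X (a + l) := by
    intro a
    have hs := singularValue_nonneg X (a + R)
    have h1 : frobeniusNorm (Z (a + R) (a + R + R)) ≤ √R * singularValue X (a + R) := by
      rw [← sq_le_sq₀ (frobeniusNorm_nonneg _) (by positivity), mul_pow, Real.sq_sqrt hR'.le,
        hv.frobeniusNorm_reweight_sq]
      calc _ ≤ ∑ i, if i ∈ blk (a + R) (a + R + R) then singularValue X (a + R) ^ 2 else 0 := by
            refine Finset.sum_le_sum fun i _ => ?_
            by_cases h : i ∈ blk (a + R) (a + R + R)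
            · simp only [h, if_true, one_mul]
              have : singularValue X i ≤ singularValue X (a + R) :=
                singularValue_antitone X (by simpa [blk] using (Finset.mem_filter.1 h).2.1)
              have := singularValue_nonneg X i
              gcongr
            · simp [h]
        _ = (blk (a + R) (a + R + R)).card * singularValue X (a + R) ^ 2 := by simp
        _ ≤ _ := by gcongr; exact hcard _
    have h2 : R * singularValue X (a + R) ≤ ∑ l ∈ Finset.range R, singularValue X (a + l) := by
      have := Finset.card_nsmul_le_sum (Finset.range R) (fun l => singularValue X (a + l))
        (singularValue X (a + R)) fun l hl => singularValue_antitone X (by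
          have := Finset.mem_range.1 hl
          omega)
      rwa [Finset.card_range, nsmul_eq_mul] at this
    calc _ ≤ √R * singularValue X (a + R) := h1
      _ = 1 / √R * (R * singularValue X (a + R)) := by
        field_simp
        rw [Real.sq_sqrt hR'.le, mul_comm]
      _ ≤ _ := by gcongr
  -- Induction on the number of blocks. A new block of Frobenius norm `b` costs `b/4` on the left
  -- and `16b/7` through the measurements, in total less than `3b`.
  have key : ∀ J : ℕ, 1 / 4 * frobeniusNorm (Z 0 (J * R + R)) ≤
      ‖measurementVec A (Z 0 (J * R + R))‖ +
        3 * (1 / √R * ∑ i ∈ Finset.range (J * R), singularValue X i) := by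
    intro J
    induction J with
    | zero => simpa using (hA.bounds hR hv (I := blk 0 R) (by simpa using hcard 0)).1
    | succ J ih =>
      have e : (J + 1) * R + R = J * R + R + R := by ring
      have e' : (J + 1) * R = J * R + R := by ring
      rw [e, e', hsplit (J * R + R) _ (by omega), Finset.sum_range_add, mul_add, mul_add, map_add]
      have hb := hblock (J * R)
      have hr := (hA.bounds hR hv (I := blk (J * R + R) (J * R + R + R)) (hcard _)).2
      have ht := frobeniusNorm_add_le (Z 0 (J * R + R)) (Z (J * R + R) (J * R + R + R))
      have ht' := norm_sub_norm_le (measurementVec A (Z 0 (J * R + R)))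
        (-measurementVec A (Z (J * R + R) (J * R + R + R)))
      rw [norm_neg, sub_neg_eq_add] at ht'
      change ‖measurementVec A (Z (J * R + R) (J * R + R + R))‖ ≤
        16 / 7 * frobeniusNorm (Z (J * R + R) (J * R + R + R)) at hr
      have hp := frobeniusNorm_nonneg (Z (J * R + R) (J * R + R + R))
      linarith
  have hlarge : n₂ ≤ n₂ * R := Nat.le_mul_of_pos_right _ hR
  have hZ : Z 0 (n₂ * R + R) = X := by
    conv_rhs => rw [← reweight_one X v]
    simp only [Z]
    congr 1
    ext i
    have : (i : ℕ) < n₂ * R + R := by omega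
    simp [blk, this]
  have hsum : ∑ i ∈ Finset.range (n₂ * R), singularValue X i = nuclearNorm X := by
    rw [nuclearNorm_eq_sum, Fin.sum_univ_eq_sum_range (singularValue X) n₂]
    refine (Finset.sum_subset (Finset.range_mono hlarge) fun i _ hi => ?_).symm
    exact singularValue_eq_zero X ((min_le_right _ _).trans (by simpa using hi))
  have := key n₂
  rw [hZ, hsum] at this
  calc _ ≤ _ := this
    _ = _ := by ring

end RestrictedIsometry

/-! ### The quotient property -/

section Quotient

open scoped InnerProductSpace

variable {n₁ n₂ m : ℕ}

/-- The adjoint of the measurement map as a linear map on Euclidean space. -/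
def adjointVec (A : Fin m → Matrix (Fin n₁) (Fin n₂) ℝ) :
    EuclideanSpace ℝ (Fin m) →ₗ[ℝ] Matrix (Fin n₁) (Fin n₂) ℝ where
  toFun q := measurementAdjoint A q
  map_add' p q := by simp [measurementAdjoint, add_smul, Finset.sum_add_distrib]
  map_smul' c q := by simp [measurementAdjoint, mul_smul, Finset.smul_sum]

theorem frobeniusInner_adjointVec (A : Fin m → Matrix (Fin n₁) (Fin n₂) ℝ)
    (q : EuclideanSpace ℝ (Fin m)) (X : Matrix (Fin n₁) (Fin n₂) ℝ) :
    frobeniusInner X (adjointVec A q) = ⟪measurementVec A X, q⟫_ℝ := by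
  change frobeniusInner X (measurementAdjoint A q) = _
  rw [frobeniusInner_measurementAdjoint, PiLp.inner_apply]
  exact Finset.sum_congr rfl fun i _ => mul_comm _ _

/-- If the adjoint is bounded below then every vector is the measurement of a small matrix. -/
theorem exists_measurementVec_eq {A : Fin m → Matrix (Fin n₁) (Fin n₂) ℝ} {c : ℝ} (hc : 0 < c)
    (h : ∀ q, c * ‖q‖ ≤ frobeniusNorm (adjointVec A q)) (b : EuclideanSpace ℝ (Fin m)) :
    ∃ X, measurementVec A X = b ∧ c * frobeniusNorm X ≤ ‖b‖ := by
  have hinner : ∀ q, frobeniusNorm (adjointVec A q) ^ 2 =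
      ⟪measurementVec A (adjointVec A q), q⟫_ℝ := fun q => by
    rw [frobeniusNorm_sq_eq_inner, frobeniusInner_adjointVec]
  let G : EuclideanSpace ℝ (Fin m) →ₗ[ℝ] EuclideanSpace ℝ (Fin m) :=
    measurementVec A ∘ₗ adjointVec A
  have hG : Function.Injective G := by
    rw [← LinearMap.ker_eq_bot, LinearMap.ker_eq_bot']
    intro q hq
    have h1 := hinner q
    rw [show measurementVec A (adjointVec A q) = 0 from hq, inner_zero_left,
      sq_eq_zero_iff] at h1
    have h2 := h q
    rw [h1] at h2
    exact norm_le_zero_iff.1 (by nlinarith [norm_nonneg q])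
  -- The preimage is `X = 𝒜^*(q)` with `𝒜𝒜^*(q) = b`. It satisfies `‖X‖_F² = ⟪b, q⟫ ≤ ‖b‖ ‖q‖ ≤ ‖b‖
  -- ‖X‖_F / c`.
  obtain ⟨q, hq⟩ := (LinearMap.injective_iff_surjective.1 hG) b
  refine ⟨adjointVec A q, hq, ?_⟩
  have h1 := hinner q
  rw [show measurementVec A (adjointVec A q) = b from hq] at h1
  have h2 := real_inner_le_norm b q
  have h3 := h q
  rcases (frobeniusNorm_nonneg (adjointVec A q)).eq_or_lt with h0 | h0
  · rw [← h0]; simp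
  · refine le_of_mul_le_mul_right ?_ h0
    calc c * frobeniusNorm (adjointVec A q) * frobeniusNorm (adjointVec A q)
        = c * frobeniusNorm (adjointVec A q) ^ 2 := by ring
      _ ≤ c * (‖b‖ * ‖q‖) := by rw [h1]; gcongr
      _ = ‖b‖ * (c * ‖q‖) := by ring
      _ ≤ _ := by gcongr

variable {Ω : Type*} [MeasurableSpace Ω] {P : Measure Ω}
  [IsProbabilityMeasure P] {A : Ω → Fin m → Matrix (Fin n₁) (Fin n₂) ℝ} {z : Ω → Fin m → ℝ}
  {σ : ℝ≥0}

/-- The bilinear net lemma is applied to scalar multiplication `ℝ × ℝᵐ → ℝᵐ`, hence the exponent `1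
+ m`. -/
theorem prob_adjointVec_lt_le (hA : IsGaussianEnsemble P A) (hm : 0 < m) :
    P.real {ω | ¬ ∀ q, 1 / 4 * √((n₁ * n₂ : ℕ) / m) * ‖q‖ ≤
        frobeniusNorm (adjointVec (A ω) q)} ≤
      33 ^ (1 + m) * (2 * Real.exp (-(1 / 16 * (n₁ * n₂ : ℕ)))) := by
  obtain ⟨s, hs, hs', hsc⟩ := exists_net ℝ
  obtain ⟨t, ht, ht', htc⟩ := exists_net (EuclideanSpace ℝ (Fin m))
  let bad : ℝ × EuclideanSpace ℝ (Fin m) → Set Ω := fun p =>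
    {ω | ¬ (49 / 100 * ((n₁ * n₂ : ℕ) / m * ∑ i, (p.1 • p.2) i ^ 2) ≤
        frobeniusNorm (measurementAdjoint (A ω) (p.1 • p.2)) ^ 2 ∧
      frobeniusNorm (measurementAdjoint (A ω) (p.1 • p.2)) ^ 2 ≤
        4 * ((n₁ * n₂ : ℕ) / m * ∑ i, (p.1 • p.2) i ^ 2))}
  have hsub : {ω | ¬ ∀ q, 1 / 4 * √((n₁ * n₂ : ℕ) / m) * ‖q‖ ≤
        frobeniusNorm (adjointVec (A ω) q)} ⊆ ⋃ p ∈ s ×ˢ t, bad p := by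
    intro ω hω
    by_contra hcon
    simp only [Set.mem_iUnion, not_exists, bad, Set.mem_ofPred_eq, not_not] at hcon
    apply hω
    have hN : (0 : ℝ) ≤ (n₁ * n₂ : ℕ) / m := by positivity
    obtain ⟨-, h2⟩ := norm_comp_bilinear_ge_of_net
      (LinearMap.lsmul ℝ (EuclideanSpace ℝ (Fin m))) (vec ∘ₗ adjointVec (A ω))
      LinearMap.id hs hs' ht ht' (fun x y => by simp [norm_smul]) (c := √((n₁ * n₂ : ℕ) / m))
      (fun p hp q hq => by
        have := hcon (p, q) (Finset.mem_product.2 ⟨hp, hq⟩)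
        change 49 / 100 * ((n₁ * n₂ : ℕ) / m * ∑ i, (p • q) i ^ 2) ≤
          frobeniusNorm (adjointVec (A ω) (p • q)) ^ 2 ∧
          frobeniusNorm (adjointVec (A ω) (p • q)) ^ 2 ≤
          4 * ((n₁ * n₂ : ℕ) / m * ∑ i, (p • q) i ^ 2) at this
        rw [← EuclideanSpace.real_norm_sq_eq, ← norm_vec] at this
        simp only [LinearMap.lsmul_apply, LinearMap.comp_apply, LinearMap.id_apply]
        constructor
        · rw [← sq_le_sq₀ (by positivity) (norm_nonneg _), mul_pow, mul_pow, Real.sq_sqrt hN]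
          refine le_trans (le_of_eq ?_) this.1
          ring
        · rw [← sq_le_sq₀ (norm_nonneg _) (by positivity), mul_pow, mul_pow, Real.sq_sqrt hN]
          refine this.2.trans (le_of_eq ?_)
          ring) (Real.sqrt_nonneg _)
    intro q
    rcases eq_or_ne q 0 with rfl | hq
    · simp [frobeniusNorm_nonneg]
    · have hq' : 0 < ‖q‖ := norm_pos_iff.2 hq
      have h := h2 1 (‖q‖⁻¹ • q) (by simp)
        (by rw [norm_smul, norm_inv, norm_norm, inv_mul_cancel₀ hq'.ne'])
        (by simp [norm_smul, hq'.ne'])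
      simp only [LinearMap.lsmul_apply, LinearMap.comp_apply, one_smul, map_smul, norm_smul,
        norm_inv, norm_norm, norm_vec] at h
      rw [inv_mul_eq_div, le_div_iff₀ hq'] at h
      exact h
  calc _ ≤ P.real (⋃ p ∈ s ×ˢ t, bad p) := measureReal_mono hsub (measure_ne_top _ _)
    _ ≤ ∑ p ∈ s ×ˢ t, P.real (bad p) := measureReal_biUnion_finset_le _ _
    _ ≤ ∑ p ∈ s ×ˢ t, 2 * Real.exp (-(1 / 16 * (n₁ * n₂ : ℕ))) :=
        Finset.sum_le_sum fun p _ => measurementAdjoint_distortion hA hm _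
    _ = (s.card * t.card : ℕ) * (2 * Real.exp (-(1 / 16 * (n₁ * n₂ : ℕ)))) := by
        rw [Finset.sum_const, Finset.card_product, nsmul_eq_mul]
    _ ≤ _ := by
        gcongr
        rw [pow_add]
        have h1 : s.card ≤ 33 ^ 1 := by simpa using hsc
        have h2 : t.card ≤ 33 ^ m := by simpa using htc
        exact_mod_cast Nat.mul_le_mul h1 h2

end Quotient

/-! ### The operator norm of the effective noise -/

section Noise

open scoped InnerProductSpace

variable {n₁ n₂ m : ℕ}

/-- The rank one matrix `x yᵀ`, as a bilinear map. -/
def rankOne (n₁ n₂ : ℕ) : EuclideanSpace ℝ (Fin n₁) →ₗ[ℝ] EuclideanSpace ℝ (Fin n₂) →ₗ[ℝ]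
    Matrix (Fin n₁) (Fin n₂) ℝ :=
  LinearMap.mk₂ ℝ (fun x y => Matrix.of fun j k => x j * y k)
    (fun _ _ _ => by ext; simp [add_mul]) (fun _ _ _ => by ext; simp [mul_assoc])
    (fun _ _ _ => by ext; simp [mul_add]) (fun _ _ _ => by ext; simp [mul_left_comm])

theorem frobeniusNorm_rankOne (x : EuclideanSpace ℝ (Fin n₁)) (y : EuclideanSpace ℝ (Fin n₂)) :
    frobeniusNorm (rankOne n₁ n₂ x y) = ‖x‖ * ‖y‖ := by
  rw [← sq_eq_sq₀ (frobeniusNorm_nonneg _) (by positivity), frobeniusNorm_sq, mul_pow,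
    EuclideanSpace.real_norm_sq_eq, EuclideanSpace.real_norm_sq_eq, Finset.sum_mul_sum]
  simp [rankOne, mul_pow]

theorem frobeniusInner_rankOne (x : EuclideanSpace ℝ (Fin n₁)) (y : EuclideanSpace ℝ (Fin n₂))
    (T : Matrix (Fin n₁) (Fin n₂) ℝ) :
    frobeniusInner (rankOne n₁ n₂ x y) T = ⟪x, Matrix.toEuclideanLin T y⟫_ℝ := by
  simp only [frobeniusInner, PiLp.inner_apply]
  refine Finset.sum_congr rfl fun j _ => ?_
  simp [rankOne, Matrix.mulVec, dotProduct, Finset.mul_sum, mul_comm, mul_left_comm]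

/-- The inner product of the measurements with a fixed vector. -/
def measurementDot (A : Fin m → Matrix (Fin n₁) (Fin n₂) ℝ) (w : Fin m → ℝ) :
    Matrix (Fin n₁) (Fin n₂) ℝ →ₗ[ℝ] ℝ where
  toFun X := ∑ i, measurementMap A X i * w i
  map_add' X Y := by simp [measurementMap_add, add_mul, Finset.sum_add_distrib]
  map_smul' c X := by simp [measurementMap_smul, Finset.mul_sum, mul_assoc]

theorem opNorm_le_of_inner {X : Matrix (Fin n₁) (Fin n₂) ℝ} {c : ℝ} (hc : 0 ≤ c)
    (h : ∀ x y, ⟪x, Matrix.toEuclideanLin X y⟫_ℝ ≤ c * ‖x‖ * ‖y‖) : opNorm X ≤ c := by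
  refine opNorm_le hc fun y => ?_
  have h1 := h (Matrix.toEuclideanLin X y) y
  rw [real_inner_self_eq_norm_sq] at h1
  rcases (norm_nonneg (Matrix.toEuclideanLin X y)).eq_or_lt with h0 | h0
  · rw [← h0]; positivity
  · refine le_of_mul_le_mul_right ?_ h0
    calc _ = ‖Matrix.toEuclideanLin X y‖ ^ 2 := by ring
      _ ≤ _ := h1
      _ = _ := by ring

variable {Ω : Type*} [MeasurableSpace Ω] {P : Measure Ω}
  [IsProbabilityMeasure P] {A : Ω → Fin m → Matrix (Fin n₁) (Fin n₂) ℝ} {z : Ω → Fin m → ℝ}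
  {σ : ℝ≥0}

theorem prob_noise_ne_zero (hz : IsGaussianNoise P 0 z) : P.real {ω | ¬ z ω = 0} = 0 := by
  have h : ∀ᵐ ω ∂P, ∀ i, z ω i = 0 := by
    rw [ae_all_iff]
    intro i
    have hl := hz.law i
    have h1 : ∀ᵐ x ∂(P.map fun ω => z ω i), x = 0 := by
      rw [hl.map_eq]
      simp [ae_dirac_eq]
    exact ae_of_ae_map hl.aemeasurable h1
  rw [measureReal_eq_zero_iff]
  refine measure_mono_null ?_ (ae_iff.1 h)
  intro ω hω hcon
  exact hω (funext hcon)

/-- This lets a full-rank `T` count as noise. Against a fixed rank-one matrix, `𝒜^*(𝒜(T) + z)`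
deviates from `T` by at most `11 √n σ`; the Frobenius bound on `T` limits the variance, and its
operator norm bounds the mean. A net over pairs of vectors gives the supremum. -/
theorem prob_opNorm_noise_gt_le (hA : IsGaussianEnsemble P A) (hz : IsGaussianNoise P σ z)
    (hAz : IndepFun (fun (ω : Ω) (p : Fin m × Fin n₁ × Fin n₂) => A ω p.1 p.2.1 p.2.2) z P)
    {n : ℕ} (hn : 0 < n) (hnm : 100 * n ≤ m) {T : Matrix (Fin n₁) (Fin n₂) ℝ}
    (hT : opNorm T ≤ √n * σ) (hTF : frobeniusNorm T ^ 2 ≤ m * σ ^ 2 / 5) :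
    P.real {ω | ¬ opNorm (measurementAdjoint (A ω) (measurementMap (A ω) T + z ω)) ≤
      16 * √n * σ} ≤ 33 ^ (n₁ + n₂) * (4 * Real.exp (-(25 / 2 * n))) := by
  rcases eq_or_ne σ 0 with rfl | hσ
  · have hT0 : T = 0 := by
      have h0 : frobeniusNorm T ^ 2 = 0 := le_antisymm (by simpa using hTF) (sq_nonneg _)
      rw [sq_eq_zero_iff, ← norm_vec, norm_eq_zero] at h0
      ext j k
      exact congrArg (fun x : EuclideanSpace ℝ (Fin n₁ × Fin n₂) => x (j, k)) h0
    refine le_trans ?_ (by positivity : (0 : ℝ) ≤ _)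
    rw [← prob_noise_ne_zero hz]
    refine measureReal_mono (fun ω hω hcon => hω ?_) (measure_ne_top _ _)
    have e : measurementMap (A ω) T + z ω = 0 := by
      rw [hcon, hT0]; ext i; simp [measurementMap_apply]
    rw [e]
    simp [measurementAdjoint, opNorm]
  have hσ' : 0 < σ := pos_iff_ne_zero.2 hσ
  obtain ⟨s, hs, hs', hsc⟩ := exists_net (EuclideanSpace ℝ (Fin n₁))
  obtain ⟨t, ht, ht', htc⟩ := exists_net (EuclideanSpace ℝ (Fin n₂))
  let bad : EuclideanSpace ℝ (Fin n₁) × EuclideanSpace ℝ (Fin n₂) → Set Ω := fun p =>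
    {ω | ¬ |∑ i, measurementMap (A ω) (rankOne n₁ n₂ p.1 p.2) i *
        (measurementMap (A ω) T i + z ω i) - frobeniusInner (rankOne n₁ n₂ p.1 p.2) T| ≤
        11 * √n * σ}
  have hsub : {ω | ¬ opNorm (measurementAdjoint (A ω) (measurementMap (A ω) T + z ω)) ≤
      16 * √n * σ} ⊆ ⋃ p ∈ s ×ˢ t, bad p := by
    intro ω hω
    by_contra hcon
    simp only [Set.mem_iUnion, not_exists, bad, Set.mem_ofPred_eq, not_not] at hcon
    apply hω
    -- Deviation `11` plus mean `1` gives `12`, and `(8/7) * 12 < 16`.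
    have hnet := norm_comp_bilinear_le_of_net (rankOne n₁ n₂)
      (measurementDot (A ω) (measurementMap (A ω) T + z ω)) hs hs' ht' (κ := 12 * √n * σ)
      (fun p hp q hq => by
        have h1 := hcon (p, q) (Finset.mem_product.2 ⟨hp, hq⟩)
        have h2 : |frobeniusInner (rankOne n₁ n₂ p q) T| ≤ √n * σ := by
          rw [frobeniusInner_rankOne]
          have h3 := abs_real_inner_le_norm p (Matrix.toEuclideanLin T q)
          have h4 := norm_toEuclideanLin_le T q
          calc _ ≤ ‖p‖ * ‖Matrix.toEuclideanLin T q‖ := h3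
            _ ≤ 1 * (√n * σ * 1) := by
              gcongr
              · exact hs p hp
              · exact h4.trans (by gcongr; exact ht q hq)
            _ = _ := by ring
        rw [Real.norm_eq_abs]
        change |∑ i, measurementMap (A ω) (rankOne n₁ n₂ p q) i *
          (measurementMap (A ω) T i + z ω i)| ≤ _
        rw [abs_le] at h1 h2 ⊢
        constructor <;> linarith)
    refine opNorm_le_of_inner (by positivity) fun x y => ?_
    rw [← frobeniusInner_rankOne, frobeniusInner_measurementAdjoint]
    refine (le_abs_self _).trans ((hnet x y).trans ?_)
    gcongr ?_ * _ * _
    have : 0 ≤ √(n : ℝ) * σ := by positivity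
    linarith
  calc _ ≤ P.real (⋃ p ∈ s ×ˢ t, bad p) := measureReal_mono hsub (measure_ne_top _ _)
    _ ≤ ∑ p ∈ s ×ˢ t, P.real (bad p) := measureReal_biUnion_finset_le _ _
    _ ≤ ∑ p ∈ s ×ˢ t, 4 * Real.exp (-(25 / 2 * n)) :=
        Finset.sum_le_sum fun p hp => measurementMap_correlation hA hz hAz hσ' hn hnm _ _ (by
          obtain ⟨h1, h2⟩ := Finset.mem_product.1 hp
          rw [frobeniusNorm_rankOne]
          exact mul_le_one₀ (hs _ h1) (norm_nonneg _) (ht _ h2)) hTF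
    _ = (s.card * t.card : ℕ) * (4 * Real.exp (-(25 / 2 * n))) := by
        rw [Finset.sum_const, Finset.card_product, nsmul_eq_mul]
    _ ≤ _ := by
        gcongr
        rw [pow_add]
        have h1 : s.card ≤ 33 ^ n₁ := by simpa using hsc
        have h2 : t.card ≤ 33 ^ n₂ := by simpa using htc
        exact_mod_cast Nat.mul_le_mul h1 h2

end Noise

/-! ### Deterministic error bounds -/

section ErrorBound

open scoped InnerProductSpace

variable {n₁ n₂ m : ℕ}

theorem measurement_inner_le {A : Fin m → Matrix (Fin n₁) (Fin n₂) ℝ} {q : Fin m → ℝ} {lam : ℝ}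
    (hq : opNorm (measurementAdjoint A q) ≤ lam) (X : Matrix (Fin n₁) (Fin n₂) ℝ) :
    ∑ i, measurementMap A X i * q i ≤ lam * nuclearNorm X := by
  rw [← frobeniusInner_measurementAdjoint]
  exact (frobeniusInner_le_nuclearNorm _ _).trans
    (mul_le_mul_of_nonneg_right hq (nuclearNorm_nonneg X))

theorem opNorm_measurementAdjoint_neg (A : Fin m → Matrix (Fin n₁) (Fin n₂) ℝ) (q : Fin m → ℝ) :
    opNorm (measurementAdjoint A (-q)) = opNorm (measurementAdjoint A q) := by
  have : measurementAdjoint A (-q) = -measurementAdjoint A q := by simp [measurementAdjoint]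
  rw [this]; simp [opNorm]

variable {A : Fin m → Matrix (Fin n₁) (Fin n₂) ℝ} {X Mhat S : Matrix (Fin n₁) (Fin n₂) ℝ}
  {v : OrthonormalBasis (Fin n₂) ℝ (EuclideanSpace ℝ (Fin n₂))} {I : Finset (Fin n₂)}
  {w : Fin m → ℝ} {lam : ℝ}

/-- The deviations of a Dantzig solution from `M₀`, when the observations are `𝒜(M₀ + S) + w`. -/
theorem IsDantzigSolution.cone_bounds (hv : IsSingularBasis X v)
    {M₀ : Matrix (Fin n₁) (Fin n₂) ℝ} (hM₀ : M₀ = reweight X v fun i => if i ∈ I then 1 else 0)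
    (hw : opNorm (measurementAdjoint A w) ≤ lam)
    (h : IsDantzigSolution A (measurementMap A (M₀ + S) + w) lam Mhat) :
    nuclearNorm (Mhat - M₀) ≤ 3 * nuclearNorm S + 6 * √I.card * frobeniusNorm (Mhat - M₀) ∧
    ‖measurementVec A (Mhat - M₀ - S)‖ ^ 2 ≤
      6 * lam * (nuclearNorm S + 2 * √I.card * frobeniusNorm (Mhat - M₀)) := by
  have hlam : 0 ≤ lam := (opNorm_nonneg _).trans hw
  have hfeas : DantzigFeasible A (measurementMap A (M₀ + S) + w) lam (M₀ + S) := by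
    rw [DantzigFeasible, add_sub_cancel_left]; exact hw
  have h1 := (h.2 _ hfeas).trans (nuclearNorm_add_le M₀ S)
  have h2 := nuclearNorm_add_nuclearNorm_le hv I (Mhat - M₀)
  rw [← hM₀, add_sub_cancel] at h2
  have hS := nuclearNorm_nonneg S
  have hr : 0 ≤ √I.card * frobeniusNorm (Mhat - M₀) :=
    mul_nonneg (Real.sqrt_nonneg _) (frobeniusNorm_nonneg _)
  refine ⟨by linarith, ?_⟩
  set H := Mhat - M₀ - S with hH
  have h3 := nuclearNorm_sub_le (Mhat - M₀) S
  have h4 := measurement_inner_le hw H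
  have h5 := measurement_inner_le (A := A) (lam := lam) (q := -(measurementMap A (M₀ + S) + w -
    measurementMap A Mhat)) (by rw [opNorm_measurementAdjoint_neg]; exact h.1) H
  -- `𝒜(H)` is the noise `w` minus the residual of `Mhat`, and feasibility bounds the adjoint at
  -- either one by `lam`; thus `‖𝒜(H)‖² ≤ 2 lam ‖H‖_*`.
  have h6 : ‖measurementVec A H‖ ^ 2 = ∑ i, measurementMap A H i * w i +
      ∑ i, measurementMap A H i * (-(measurementMap A (M₀ + S) + w - measurementMap A Mhat)) i := by
    rw [norm_measurementVec_sq, ← Finset.sum_add_distrib]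
    refine Finset.sum_congr rfl fun i _ => ?_
    have : measurementMap A H = measurementMap A Mhat - measurementMap A (M₀ + S) := by
      rw [← measurementMap_sub, hH, sub_sub]
    simp only [this, Pi.neg_apply, Pi.sub_apply, Pi.add_apply]
    ring
  have h7 : lam * nuclearNorm H ≤
      lam * (2 * nuclearNorm S + 3 * (√I.card * frobeniusNorm (Mhat - M₀))) := by
    gcongr; linarith
  have h8 := mul_nonneg hlam hS
  have h9 := mul_nonneg hlam hr
  linarith

/-- The deviations of a Lasso solution from `M₀`, when the observations are `𝒜(M₀ + S) + w`. -/
theorem IsLassoSolution.cone_bounds (hv : IsSingularBasis X v)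
    {M₀ : Matrix (Fin n₁) (Fin n₂) ℝ} (hM₀ : M₀ = reweight X v fun i => if i ∈ I then 1 else 0)
    (hw : opNorm (measurementAdjoint A w) ≤ lam) (hlam : 0 < lam)
    (h : IsLassoSolution A (measurementMap A (M₀ + S) + w) (2 * lam) Mhat) :
    nuclearNorm (Mhat - M₀) ≤ 3 * nuclearNorm S + 6 * √I.card * frobeniusNorm (Mhat - M₀) ∧
    ‖measurementVec A (Mhat - M₀ - S)‖ ^ 2 ≤
      6 * lam * (nuclearNorm S + 2 * √I.card * frobeniusNorm (Mhat - M₀)) := by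
  have h1 := nuclearNorm_add_le M₀ S
  have h2 := nuclearNorm_add_nuclearNorm_le hv I (Mhat - M₀)
  rw [← hM₀, add_sub_cancel] at h2
  set H := Mhat - M₀ - S with hH
  have h3 := nuclearNorm_sub_le (Mhat - M₀) S
  have h4 := measurement_inner_le hw H
  have h5 := h (M₀ + S)
  simp only [lassoObjective] at h5
  have e1 : ∑ i, (measurementMap A (M₀ + S) i - (measurementMap A (M₀ + S) + w) i) ^ 2 =
      ∑ i, w i ^ 2 := Finset.sum_congr rfl fun i _ => by simp
  have e2 : ∑ i, (measurementMap A Mhat i - (measurementMap A (M₀ + S) + w) i) ^ 2 =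
      ‖measurementVec A H‖ ^ 2 - 2 * ∑ i, measurementMap A H i * w i + ∑ i, w i ^ 2 := by
    rw [norm_measurementVec_sq, Finset.mul_sum, ← Finset.sum_sub_distrib, ← Finset.sum_add_distrib]
    refine Finset.sum_congr rfl fun i _ => ?_
    have : measurementMap A H = measurementMap A Mhat - measurementMap A (M₀ + S) := by
      rw [← measurementMap_sub, hH, sub_sub]
    simp only [this, Pi.sub_apply, Pi.add_apply]
    ring
  rw [e1, e2] at h5
  have h7 : lam * nuclearNorm H ≤ lam * (nuclearNorm (Mhat - M₀) + nuclearNorm S) := by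
    gcongr
  have h8 : 2 * lam * nuclearNorm (M₀ + S) ≤ 2 * lam * (nuclearNorm M₀ + nuclearNorm S) := by
    gcongr
  have h9 : 2 * lam * (nuclearNorm M₀ + nuclearNorm (Mhat - M₀)) ≤
      2 * lam * (nuclearNorm Mhat + 3 * √I.card * frobeniusNorm (Mhat - M₀)) := by gcongr
  -- The noise contributes at most `lam ‖E‖_* + lam ‖S‖_*`, where `E = Mhat - M₀`. The penalty
  -- weight `2 * lam` leaves `-lam ‖E‖_*` over; both conclusions can be read off.
  have h10 : 1 / 2 * ‖measurementVec A H‖ ^ 2 ≤ lam * (3 * nuclearNorm S +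
      6 * √I.card * frobeniusNorm (Mhat - M₀) - nuclearNorm (Mhat - M₀)) := by linarith
  constructor
  · have h11 : 0 ≤ lam * (3 * nuclearNorm S +
        6 * √I.card * frobeniusNorm (Mhat - M₀) - nuclearNorm (Mhat - M₀)) :=
      le_trans (by positivity) h10
    have := nonneg_of_mul_nonneg_right h11 hlam
    linarith
  · have := mul_nonneg hlam.le (nuclearNorm_nonneg (Mhat - M₀))
    linarith

/-- The error bound for restricted isometries, from the bounds that hold for both estimators. -/
theorem frobeniusNorm_sq_le_of_cone_bounds {R r : ℕ} (hR : 0 < R) (hrR : 20736 * r ≤ R)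
    (hA : IsRestrictedIsometry A R) (hlam : 0 ≤ lam) {E : Matrix (Fin n₁) (Fin n₂) ℝ}
    (h1 : nuclearNorm E ≤ 3 * nuclearNorm S + 6 * √r * frobeniusNorm E)
    (h2 : ‖measurementVec A (E - S)‖ ^ 2 ≤
      6 * lam * (nuclearNorm S + 2 * √r * frobeniusNorm E)) :
    frobeniusNorm E ^ 2 ≤ 6000000 *
      (lam * nuclearNorm S + r * lam ^ 2 + nuclearNorm S ^ 2 / R + frobeniusNorm S ^ 2) := by
  have hR' : (0 : ℝ) < R := by exact_mod_cast hR
  have hsR : 0 < √(R : ℝ) := Real.sqrt_pos.2 hR'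
  have hr : 144 * √(r : ℝ) ≤ √R := by
    rw [← sq_le_sq₀ (by positivity) (by positivity), mul_pow, Real.sq_sqrt (by positivity),
      Real.sq_sqrt (by positivity)]
    have : (20736 : ℝ) * r ≤ R := by exact_mod_cast hrR
    linarith
  have h3 := hA.lower_bound hR (E - S)
  have h4 := nuclearNorm_sub_le E S
  have h5 : frobeniusNorm E ≤ frobeniusNorm (E - S) + frobeniusNorm S := by
    have := frobeniusNorm_add_le (E - S) S
    rwa [sub_add_cancel] at this
  have hE := frobeniusNorm_nonneg E
  set e := frobeniusNorm E
  set s := frobeniusNorm S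
  set p := nuclearNorm S / √R with hp
  have hpS : nuclearNorm S = p * √R := by rw [hp]; field_simp
  set a := ‖measurementVec A (E - S)‖
  -- The ratio `R ≥ 144² r` makes the cone term `18 √r e / √R` at most `e/8`, half of the left side
  -- of the lower bound.
  have h6 : 3 / √R * nuclearNorm (E - S) ≤ 12 * p + 1 / 8 * e := by
    calc 3 / √R * nuclearNorm (E - S) ≤ 3 / √R * (4 * nuclearNorm S + 6 * √r * e) := by
          gcongr; linarith
      _ = 12 * p + (144 * √r) / √R * (1 / 8 * e) := by rw [hp]; ring
      _ ≤ 12 * p + 1 * (1 / 8 * e) := by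
          gcongr
          exact (div_le_one hsR).2 hr
      _ = _ := by ring
  have h7 : e ≤ 8 * a + 96 * p + 2 * s := by linarith
  have ha : 0 ≤ a := norm_nonneg _
  have hs : 0 ≤ s := frobeniusNorm_nonneg S
  have hp0 : 0 ≤ p := div_nonneg (nuclearNorm_nonneg S) hsR.le
  have h8 : e ^ 2 ≤ 3 * (64 * a ^ 2 + 9216 * p ^ 2 + 4 * s ^ 2) := by
    have : e ^ 2 ≤ (8 * a + 96 * p + 2 * s) ^ 2 := by gcongr
    nlinarith [sq_nonneg (8 * a - 96 * p), sq_nonneg (8 * a - 2 * s), sq_nonneg (96 * p - 2 * s)]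
  have h9 : nuclearNorm S ^ 2 / R = p ^ 2 := by
    rw [hp, div_pow, Real.sq_sqrt hR'.le]
  have h10 : (r : ℝ) * lam ^ 2 = (√r * lam) ^ 2 := by rw [mul_pow, Real.sq_sqrt (by positivity)]
  rw [h9, h10]
  set u := √(r : ℝ) * lam
  have h11 : a ^ 2 ≤ 6 * (lam * nuclearNorm S) + 12 * u * e := by
    refine h2.trans (le_of_eq ?_); ring
  have h12 : 0 ≤ lam * nuclearNorm S := mul_nonneg hlam (nuclearNorm_nonneg S)
  -- The cross term is `192 * 12 * u * e = 2304 u e`. Half of `e²` absorbs it, which leaves the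
  -- coefficient `2304² < 6000000` of `u²`.
  nlinarith [sq_nonneg (e - 2304 * u), sq_nonneg u, sq_nonneg p, sq_nonneg s]

/-- Terms with index at least `n₂` vanish, so `r` may exceed `n₂` or even `max n₁ n₂`. -/
theorem instanceError_eq (M : Matrix (Fin n₁) (Fin n₂) ℝ) (σ : ℝ≥0) (r : ℕ) :
    instanceError M σ r = ∑ i : Fin n₂, if (i : ℕ) < r then
      min (singularValue M i ^ 2) ((max n₁ n₂ : ℕ) * (σ : ℝ) ^ 2) else singularValue M i ^ 2 := by
  let g : ℕ → ℝ := fun i => if i < r then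
      min (singularValue M i ^ 2) ((max n₁ n₂ : ℕ) * (σ : ℝ) ^ 2) else singularValue M i ^ 2
  have hg : ∀ i, n₂ ≤ i → g i = 0 := fun i hi => by
    have h0 := singularValue_eq_zero M ((min_le_right n₁ n₂).trans hi)
    simp only [g, h0]
    split_ifs
    · rw [min_eq_left] <;> [simp; (simp; positivity)]
    · simp
  have e1 : ∑ i ∈ Finset.range r,
      min (singularValue M i ^ 2) ((max n₁ n₂ : ℕ) * (σ : ℝ) ^ 2) = ∑ i ∈ Finset.range r, g i :=
    Finset.sum_congr rfl fun i hi => by simp [g, Finset.mem_range.1 hi]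
  have e2 : ∑ i ∈ Finset.Ico r (max n₁ n₂), singularValue M i ^ 2 =
      ∑ i ∈ Finset.Ico r (max r (max n₁ n₂)), g i := by
    rw [← Finset.sum_subset (Finset.Ico_subset_Ico_right (le_max_right r (max n₁ n₂)))]
    · exact Finset.sum_congr rfl fun i hi => by
        simp [g, not_lt.2 (Finset.mem_Ico.1 hi).1]
    · intro i hi hi'
      simp only [Finset.mem_Ico, not_and, not_lt] at hi hi'
      exact hg i ((le_max_right _ _).trans (hi' hi.1))
  rw [instanceError, e1, e2, Finset.sum_range_add_sum_Ico _ (le_max_left _ _),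
    Fin.sum_univ_eq_sum_range g n₂]
  refine (Finset.sum_subset (Finset.range_mono ?_) fun i _ hi => hg i (by simpa using hi)).symm
  exact (le_max_right _ _).trans (le_max_right _ _)

/-- The split of a matrix into its singular components above the noise level and the rest. -/
theorem exists_split (M : Matrix (Fin n₁) (Fin n₂) ℝ) (σ : ℝ≥0) {r r₀ : ℕ} (hr : r ≤ r₀) :
    ∃ v, IsSingularBasis M v ∧ ∃ (I : Finset (Fin n₂)) (T : Matrix (Fin n₁) (Fin n₂) ℝ),
      I.card ≤ r₀ ∧ M = (reweight M v fun i => if i ∈ I then 1 else 0) + T ∧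
      I.card * ((max n₁ n₂ : ℕ) * (σ : ℝ) ^ 2) + frobeniusNorm T ^ 2 ≤ instanceError M σ r ∧
      (I.card = r₀ ∨ opNorm T ≤ √(max n₁ n₂ : ℕ) * σ) := by
  classical
  obtain ⟨v, hv⟩ := exists_isSingularBasis M
  set τ : ℝ := (max n₁ n₂ : ℕ) * (σ : ℝ) ^ 2 with hτ
  have hτ0 : 0 ≤ τ := by positivity
  let I : Finset (Fin n₂) := Finset.univ.filter fun i => (i : ℕ) < r₀ ∧ τ < singularValue M i ^ 2
  have hI : ∀ i, i ∈ I ↔ (i : ℕ) < r₀ ∧ τ < singularValue M i ^ 2 := fun i => by simp [I]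
  refine ⟨v, hv, I, reweight M v fun i => if i ∈ I then 0 else 1, ?_, ?_, ?_, ?_⟩
  · calc I.card = (I.image Fin.val).card :=
          (Finset.card_image_of_injective _ Fin.val_injective).symm
      _ ≤ (Finset.range r₀).card := by
          refine Finset.card_le_card fun i hi => ?_
          obtain ⟨j, hj, rfl⟩ := Finset.mem_image.1 hi
          exact Finset.mem_range.2 ((hI j).1 hj).1
      _ = r₀ := by simp
  · conv_lhs => rw [← reweight_one M v]
    rw [reweight_add]
    congr 1
    ext i
    by_cases h : i ∈ I <;> simp [h]
  · rw [hv.frobeniusNorm_reweight_sq, instanceError_eq]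
    have e : (I.card : ℝ) * τ = ∑ i, if i ∈ I then τ else 0 := by simp
    rw [e, ← Finset.sum_add_distrib]
    refine Finset.sum_le_sum fun i _ => ?_
    rw [← hτ]
    by_cases h : i ∈ I
    · have := ((hI i).1 h).2
      simp only [h, if_true, zero_mul]
      split_ifs
      · rw [min_eq_right this.le]; simp
      · simpa using this.le
    · simp only [h, if_false, one_mul, zero_add]
      split_ifs with h1
      · rw [min_eq_left]
        by_contra! hcon
        exact h ((hI i).2 ⟨h1.trans_le hr, hcon⟩)
      · exact le_rfl
  -- If a component above the threshold is left out, its index is at least `r₀`; by monotonicity all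
  -- of the first `r₀` components exceed the threshold, so `I` is full.
  · by_cases hbig : ∃ i, i ∉ I ∧ τ < singularValue M i ^ 2
    · left
      obtain ⟨i, hi, hi'⟩ := hbig
      have hri : r₀ ≤ i := by
        by_contra! h
        exact hi ((hI i).2 ⟨h, hi'⟩)
      have hall : ∀ j : Fin n₂, (j : ℕ) < r₀ → j ∈ I := fun j hj => by
        refine (hI j).2 ⟨hj, hi'.trans_le ?_⟩
        have := singularValue_antitone M (hj.le.trans hri)
        have := singularValue_nonneg M i
        gcongr
      have hsub : Finset.range r₀ ⊆ I.image Fin.val := fun j hj => by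
        have hj' := Finset.mem_range.1 hj
        exact Finset.mem_image.2 ⟨⟨j, hj'.trans_le (hri.trans i.2.le)⟩, hall _ hj', rfl⟩
      refine le_antisymm ?_ ?_
      · calc I.card = (I.image Fin.val).card :=
              (Finset.card_image_of_injective _ Fin.val_injective).symm
          _ ≤ (Finset.range r₀).card := by
              refine Finset.card_le_card fun i hi => ?_
              obtain ⟨j, hj, rfl⟩ := Finset.mem_image.1 hi
              exact Finset.mem_range.2 ((hI j).1 hj).1
          _ = r₀ := by simp
      · have := Finset.card_le_card hsub
        rwa [Finset.card_range, Finset.card_image_of_injective _ Fin.val_injective] at this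
    · right
      push Not at hbig
      refine hv.opNorm_reweight_le (by positivity) fun i => ?_
      by_cases h : i ∈ I
      · simp [h]; positivity
      · simp only [h, if_false, one_mul]
        rw [abs_of_nonneg (singularValue_nonneg _ _),
          ← sq_le_sq₀ (singularValue_nonneg _ _) (by positivity), mul_pow,
          Real.sq_sqrt (by positivity)]
        exact hbig i h

end ErrorBound

/-! ### Good realizations and their probability -/

section Realizations

variable {n₁ n₂ m : ℕ}

theorem thirtythree_pow_le_exp (k : ℕ) : (33 : ℝ) ^ k ≤ Real.exp (4 * k) := by
  have h : (33 : ℝ) ≤ Real.exp 4 := by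
    have h1 := Real.exp_one_gt_d9
    have h2 : Real.exp 4 = Real.exp 1 ^ 4 := by rw [← Real.exp_nat_mul]; norm_num
    rw [h2]
    calc (33 : ℝ) ≤ 2.7182818283 ^ 4 := by norm_num
      _ ≤ _ := by gcongr
  calc (33 : ℝ) ^ k ≤ Real.exp 4 ^ k := by gcongr
    _ = _ := by rw [← Real.exp_nat_mul, mul_comm]

/-- `T` has the same measurements as a matrix of small nuclear norm. -/
def HasSmallPreimage (A : Fin m → Matrix (Fin n₁) (Fin n₂) ℝ) (T : Matrix (Fin n₁) (Fin n₂) ℝ) :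
    Prop :=
  ∃ S, measurementMap A S = measurementMap A T ∧ frobeniusNorm S ≤ frobeniusNorm T ∧
    nuclearNorm S ≤ 16 * √(m / (max n₁ n₂ : ℕ)) * frobeniusNorm T

/-- With this many measurements `T` itself serves, because `‖T‖_* ≤ √(min n₁ n₂) ‖T‖_F`. -/
theorem hasSmallPreimage_of_lt {A : Fin m → Matrix (Fin n₁) (Fin n₂) ℝ}
    {T : Matrix (Fin n₁) (Fin n₂) ℝ} (hn : 0 < max n₁ n₂) (h : n₁ * n₂ ≤ 256 * m) :
    HasSmallPreimage A T := by
  refine ⟨T, rfl, le_rfl, (nuclearNorm_le_frobeniusNorm T).trans ?_⟩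
  refine mul_le_mul_of_nonneg_right ?_ (frobeniusNorm_nonneg T)
  have hn' : (0 : ℝ) < (max n₁ n₂ : ℕ) := by exact_mod_cast hn
  rw [← sq_le_sq₀ (by positivity) (by positivity), mul_pow, Real.sq_sqrt (by positivity),
    Real.sq_sqrt (by positivity)]
  have h1 : ((min n₁ n₂ : ℕ) : ℝ) * (max n₁ n₂ : ℕ) ≤ 256 * m := by
    rw [← min_mul_max n₁ n₂] at h
    exact_mod_cast h
  rw [← mul_div_assoc, le_div_iff₀ hn']
  linarith

/-- The quotient property gives `‖S‖_F ≲ √(m / (n₁ n₂)) ‖T‖_F`. The trivial rank bound on `‖S‖_*`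
then suffices, as `min n₁ n₂ * max n₁ n₂ = n₁ n₂`. -/
theorem hasSmallPreimage_of_lower_bound {A : Fin m → Matrix (Fin n₁) (Fin n₂) ℝ}
    {T : Matrix (Fin n₁) (Fin n₂) ℝ} (hm : 0 < m) (h : 256 * m ≤ n₁ * n₂)
    (h1 : ∀ q, 1 / 4 * √((n₁ * n₂ : ℕ) / m) * ‖q‖ ≤ frobeniusNorm (adjointVec A q))
    (h2 : ∑ i, measurementMap A T i ^ 2 ≤ 4 * frobeniusNorm T ^ 2) :
    HasSmallPreimage A T := by
  have hm' : (0 : ℝ) < m := by exact_mod_cast hm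
  have hN : (256 : ℝ) * m ≤ (n₁ * n₂ : ℕ) := by exact_mod_cast h
  have hNpos : 0 < n₁ * n₂ := by omega
  have hn : 0 < max n₁ n₂ := lt_max_of_lt_left (Nat.pos_of_mul_pos_right hNpos)
  have hn' : (0 : ℝ) < (max n₁ n₂ : ℕ) := by exact_mod_cast hn
  have h16 : 16 ≤ √((n₁ * n₂ : ℕ) / m : ℝ) := by
    refine Real.le_sqrt_of_sq_le ?_
    rw [le_div_iff₀ hm']
    linarith
  have hT := frobeniusNorm_nonneg T
  have hAT : ‖measurementVec A T‖ ≤ 2 * frobeniusNorm T := by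
    rw [← sq_le_sq₀ (norm_nonneg _) (by positivity), norm_measurementVec_sq, mul_pow]
    linarith
  obtain ⟨S, hS, hS'⟩ := exists_measurementVec_eq (by positivity) h1 (measurementVec A T)
  have hSF := frobeniusNorm_nonneg S
  refine ⟨S, congrArg (fun x : EuclideanSpace ℝ (Fin m) => x.ofLp) hS, ?_, ?_⟩
  · have : 16 * frobeniusNorm S ≤ √((n₁ * n₂ : ℕ) / m : ℝ) * frobeniusNorm S := by gcongr
    linarith
  · have e : √(min n₁ n₂ : ℕ) = √((n₁ * n₂ : ℕ) / m : ℝ) * √(m / (max n₁ n₂ : ℕ)) := by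
      rw [← Real.sqrt_mul (by positivity)]
      congr 1
      rw [← min_mul_max n₁ n₂, Nat.cast_mul]
      field_simp
    calc nuclearNorm S ≤ √(min n₁ n₂ : ℕ) * frobeniusNorm S := nuclearNorm_le_frobeniusNorm S
      _ = 4 * √(m / (max n₁ n₂ : ℕ)) *
          (1 / 4 * √((n₁ * n₂ : ℕ) / m : ℝ) * frobeniusNorm S) := by rw [e]; ring
      _ ≤ 4 * √(m / (max n₁ n₂ : ℕ)) * (2 * frobeniusNorm T) := by
          exact mul_le_mul_of_nonneg_left (hS'.trans hAT) (by positivity)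
      _ ≤ _ := by
          have : 0 ≤ √(m / (max n₁ n₂ : ℕ) : ℝ) * frobeniusNorm T := by positivity
          linarith

variable {Ω : Type*} [MeasurableSpace Ω] {P : Measure Ω}
  [IsProbabilityMeasure P] {A : Ω → Fin m → Matrix (Fin n₁) (Fin n₂) ℝ} {z : Ω → Fin m → ℝ}
  {σ : ℝ≥0}

theorem prob_not_hasSmallPreimage_le (hA : IsGaussianEnsemble P A) (hz : IsGaussianNoise P σ z)
    (hAz : IndepFun (fun (ω : Ω) (p : Fin m × Fin n₁ × Fin n₂) => A ω p.1 p.2.1 p.2.2) z P)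
    {n : ℕ} (hnmax : n = max n₁ n₂) (hn : 0 < n) (hm : 16 * n ≤ m)
    (T : Matrix (Fin n₁) (Fin n₂) ℝ) :
    P.real {ω | ¬ HasSmallPreimage (A ω) T} ≤ 4 * Real.exp (-n) := by
  rcases le_total (n₁ * n₂) (256 * m) with h | h
  · have : {ω | ¬ HasSmallPreimage (A ω) T} = ∅ := by
      ext ω
      simpa using hasSmallPreimage_of_lt (hnmax ▸ hn) h
    rw [this, measureReal_empty]
    positivity
  · have hm0 : 0 < m := by omega
    have hn1 : (1 : ℝ) ≤ n := by exact_mod_cast hn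
    have hm' : 16 * (n : ℝ) ≤ m := by exact_mod_cast hm
    have hN : (256 : ℝ) * m ≤ (n₁ * n₂ : ℕ) := by exact_mod_cast h
    have b1 : P.real {ω | ¬ ∀ q, 1 / 4 * √((n₁ * n₂ : ℕ) / m) * ‖q‖ ≤
        frobeniusNorm (adjointVec (A ω) q)} ≤ 2 * Real.exp (-n) := by
      refine (prob_adjointVec_lt_le hA hm0).trans ?_
      calc _ ≤ Real.exp (4 * (1 + m : ℕ)) * (2 * Real.exp (-(1 / 16 * (n₁ * n₂ : ℕ)))) := by
            gcongr; exact thirtythree_pow_le_exp _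
        _ = 2 * Real.exp (4 * (1 + m : ℕ) + -(1 / 16 * (n₁ * n₂ : ℕ))) := by
            rw [Real.exp_add]; ring
        _ ≤ _ := by
            gcongr
            push_cast at hN ⊢
            linarith
    have b2 : P.real {ω | ¬ (49 / 100 * frobeniusNorm T ^ 2 ≤ ∑ i, measurementMap (A ω) T i ^ 2 ∧
        ∑ i, measurementMap (A ω) T i ^ 2 ≤ 4 * frobeniusNorm T ^ 2)} ≤ 2 * Real.exp (-n) := by
      refine (measurementMap_distortion hA hz hAz hm0 T).trans ?_
      gcongr
      linarith
    refine (measureReal_mono ?_ (measure_ne_top _ _)).trans ((measureReal_union_le _ _).trans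
      ((add_le_add b1 b2).trans (by linarith)))
    intro ω hω
    by_contra hcon
    simp only [Set.mem_union, Set.mem_ofPred_eq, not_or, not_not] at hcon
    exact hω (hasSmallPreimage_of_lower_bound hm0 h hcon.1 hcon.2.2)

/-- The properties of the measurements and the noise on which the error bound rests. -/
def IsGoodRealization (A : Fin m → Matrix (Fin n₁) (Fin n₂) ℝ) (z : Fin m → ℝ) (σ : ℝ≥0)
    (T T' : Matrix (Fin n₁) (Fin n₂) ℝ) : Prop :=
  IsRestrictedIsometry A (m / (256 * max n₁ n₂)) ∧ HasSmallPreimage A T ∧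
    opNorm (measurementAdjoint A (measurementMap A T' + z)) ≤ 16 * √(max n₁ n₂ : ℕ) * σ

/-- Each net has at most `e^(4 * dim)` points. The factor `256` in the rank keeps `4 R (n₁ + n₂) ≤
m/32`, below the tail exponent `m/16`; for the noise, `8n` stands against `25n/2`. -/
theorem prob_not_isGoodRealization_le (hA : IsGaussianEnsemble P A) (hz : IsGaussianNoise P σ z)
    (hAz : IndepFun (fun (ω : Ω) (p : Fin m × Fin n₁ × Fin n₂) => A ω p.1 p.2.1 p.2.2) z P)
    {n : ℕ} (hnmax : n = max n₁ n₂) (hn : 0 < n) (hm : 256 * n ≤ m)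
    (T : Matrix (Fin n₁) (Fin n₂) ℝ) {T' : Matrix (Fin n₁) (Fin n₂) ℝ}
    (hT : opNorm T' ≤ √n * σ) (hTF : frobeniusNorm T' ^ 2 ≤ m * σ ^ 2 / 5) :
    P.real {ω | ¬ IsGoodRealization (A ω) (z ω) σ T T'} ≤ 10 * Real.exp (-n) := by
  have hm0 : 0 < m := by omega
  have hm' : 256 * (n : ℝ) ≤ m := by exact_mod_cast hm
  have hnn : n₁ + n₂ ≤ 2 * n := by rw [hnmax]; omega
  have hnn' : ((n₁ + n₂ : ℕ) : ℝ) ≤ 2 * n := by exact_mod_cast hnn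
  have hn0 : (0 : ℝ) ≤ n := by positivity
  have b1 : P.real {ω | ¬ IsRestrictedIsometry (A ω) (m / (256 * n))} ≤ 2 * Real.exp (-n) := by
    refine (prob_not_isRestrictedIsometry_le hA hz hAz hm0 _).trans ?_
    have hR : 128 * (m / (256 * n) * (n₁ + n₂)) ≤ m := by
      calc 128 * (m / (256 * n) * (n₁ + n₂)) ≤ 128 * (m / (256 * n) * (2 * n)) := by gcongr
        _ = m / (256 * n) * (256 * n) := by ring
        _ ≤ m := Nat.div_mul_le_self _ _
    have hR' : 128 * ((m / (256 * n) * (n₁ + n₂) : ℕ) : ℝ) ≤ m := by exact_mod_cast hR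
    calc _ ≤ Real.exp (4 * (m / (256 * n) * (n₁ + n₂) : ℕ)) * (2 * Real.exp (-(1 / 16 * m))) := by
          gcongr; exact thirtythree_pow_le_exp _
      _ = 2 * Real.exp (4 * (m / (256 * n) * (n₁ + n₂) : ℕ) + -(1 / 16 * m)) := by
          rw [Real.exp_add]; ring
      _ ≤ _ := by gcongr; linarith
  have b2 := prob_not_hasSmallPreimage_le hA hz hAz hnmax hn (by omega) T
  have b3 : P.real {ω | ¬ opNorm (measurementAdjoint (A ω) (measurementMap (A ω) T' + z ω)) ≤
      16 * √n * σ} ≤ 4 * Real.exp (-n) := by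
    refine (prob_opNorm_noise_gt_le hA hz hAz hn (by omega) hT hTF).trans ?_
    calc _ ≤ Real.exp (4 * (n₁ + n₂ : ℕ)) * (4 * Real.exp (-(25 / 2 * n))) := by
          gcongr; exact thirtythree_pow_le_exp _
      _ = 4 * Real.exp (4 * (n₁ + n₂ : ℕ) + -(25 / 2 * n)) := by rw [Real.exp_add]; ring
      _ ≤ _ := by gcongr; linarith
  refine (measureReal_mono ?_ (measure_ne_top _ _)).trans ((measureReal_union_le _ _).trans
    ((add_le_add b1 ((measureReal_union_le _ _).trans (add_le_add b2 b3))).trans (by linarith)))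
  intro ω hω
  by_contra hcon
  simp only [Set.mem_union, Set.mem_ofPred_eq, not_or, not_not] at hcon
  refine hω ⟨?_, hcon.2.1, ?_⟩
  · rw [← hnmax]; exact hcon.1
  · rw [← hnmax]; exact hcon.2.2

end Realizations

/-! ### Combination of the cases -/

section Main

variable {n₁ n₂ m : ℕ}

/-- For every matrix there are a rank cut and two test matrices such that both estimators obey the
error bound on good realizations. -/
theorem error_bound_of_isGoodRealization (M : Matrix (Fin n₁) (Fin n₂) ℝ) (σ : ℝ≥0) {n r : ℕ}
    (hnmax : n = max n₁ n₂) (hn : 0 < n) (hm : 5308416 * n ≤ m) (hr : r * (5308416 * n) ≤ m) :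
    ∃ T T' : Matrix (Fin n₁) (Fin n₂) ℝ, opNorm T' ≤ √n * σ ∧
      frobeniusNorm T' ^ 2 ≤ m * σ ^ 2 / 5 ∧
      ∀ (A : Fin m → Matrix (Fin n₁) (Fin n₂) ℝ) (z : Fin m → ℝ), IsGoodRealization A z σ T T' →
      ∀ Mhat, (IsDantzigSolution A (measurementMap A M + z) (16 * √n * σ) Mhat ∨
        0 < σ ∧ IsLassoSolution A (measurementMap A M + z) (32 * √n * σ) Mhat) →
      frobeniusNorm (Mhat - M) ^ 2 ≤ 10 ^ 17 * instanceError M σ r := by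
  have hm0 : 0 < m := by omega
  have hn' : (0 : ℝ) < n := by exact_mod_cast hn
  have hm' : (0 : ℝ) < m := by exact_mod_cast hm0
  obtain ⟨R, hR⟩ : ∃ R, R = m / (256 * n) := ⟨_, rfl⟩
  -- The cone argument needs `144² r₀ ≤ R`; the threshold `5308416 = 256 * 20736` ensures `r₀ ≥ 1`
  -- and `r ≤ r₀`.
  obtain ⟨r₀, hr₀⟩ : ∃ r₀, r₀ = R / 20736 := ⟨_, rfl⟩
  have hRm : R * (256 * n) ≤ m := hR ▸ Nat.div_mul_le_self _ _
  have hRbig : 20736 ≤ R := by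
    rw [hR, Nat.le_div_iff_mul_le (by positivity)]; omega
  have hmR : m ≤ 512 * (n * R) := by
    have : m < 256 * n * (R + 1) := by rw [hR]; exact Nat.lt_mul_div_succ m (by positivity)
    nlinarith
  have hr₀pos : 1 ≤ r₀ := by omega
  have hRr : R ≤ 41472 * r₀ := by omega
  have hrR : 20736 * r₀ ≤ R := by omega
  have hrr₀ : r ≤ r₀ := by
    rw [hr₀, Nat.le_div_iff_mul_le (by norm_num), hR, Nat.le_div_iff_mul_le (by positivity)]
    calc r * 20736 * (256 * n) = r * (5308416 * n) := by ring
      _ ≤ m := hr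
  have hmr : (m : ℝ) ≤ 21233664 * (r₀ * n) := by
    have : m ≤ 21233664 * (r₀ * n) := by
      calc m ≤ 512 * (n * R) := hmR
        _ ≤ 512 * (n * (41472 * r₀)) :=
          Nat.mul_le_mul_left _ (Nat.mul_le_mul_left _ hRr)
        _ = _ := by ring
    exact_mod_cast this
  have hmR' : (m : ℝ) ≤ 512 * (n * R) := by exact_mod_cast hmR
  have hRpos : (0 : ℝ) < R := by
    have : 0 < R := by omega
    exact_mod_cast this
  obtain ⟨v, hv, I, T, hIcard, hM, herr, hcase⟩ := exists_split M σ hrr₀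
  rw [← hnmax] at herr hcase
  set M₀ := reweight M v fun i => if i ∈ I then 1 else 0 with hM₀
  set lam : ℝ := 16 * √n * σ with hlam
  have hlam0 : 0 ≤ lam := by positivity
  have hlam2 : lam ^ 2 = 256 * (n * σ ^ 2) := by
    rw [hlam, mul_pow, mul_pow, Real.sq_sqrt hn'.le]; ring
  set err := instanceError M σ r
  have hT0 := sq_nonneg (frobeniusNorm T)
  have hI0 : 0 ≤ (I.card : ℝ) * (n * (σ : ℝ) ^ 2) :=
    mul_nonneg (Nat.cast_nonneg _) (by positivity)
  -- a bound for both estimators in terms of a decomposition of the observations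
  have main : ∀ (A : Fin m → Matrix (Fin n₁) (Fin n₂) ℝ) (z : Fin m → ℝ)
      (S : Matrix (Fin n₁) (Fin n₂) ℝ) (w : Fin m → ℝ), IsRestrictedIsometry A R →
      measurementMap A M + z = measurementMap A (M₀ + S) + w →
      opNorm (measurementAdjoint A w) ≤ lam →
      lam * nuclearNorm S + nuclearNorm S ^ 2 / R + frobeniusNorm S ^ 2 ≤ 3000000000 * err →
      ∀ Mhat, (IsDantzigSolution A (measurementMap A M + z) lam Mhat ∨
        0 < σ ∧ IsLassoSolution A (measurementMap A M + z) (32 * √n * σ) Mhat) →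
      frobeniusNorm (Mhat - M) ^ 2 ≤ 10 ^ 17 * err := by
    intro A z S w hA hy hw hS Mhat hMhat
    rw [hy] at hMhat
    have hcone : nuclearNorm (Mhat - M₀) ≤
        3 * nuclearNorm S + 6 * √I.card * frobeniusNorm (Mhat - M₀) ∧
        ‖measurementVec A (Mhat - M₀ - S)‖ ^ 2 ≤
        6 * lam * (nuclearNorm S + 2 * √I.card * frobeniusNorm (Mhat - M₀)) := by
      rcases hMhat with h | ⟨hσ, h⟩
      · exact h.cone_bounds hv hM₀ hw
      · have hσ' : (0 : ℝ) < σ := hσ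
        have e : 32 * √(n : ℝ) * σ = 2 * lam := by rw [hlam]; ring
        rw [e] at h
        exact h.cone_bounds hv hM₀ hw (by positivity)
    have hb := frobeniusNorm_sq_le_of_cone_bounds (by omega) (by omega) hA hlam0 hcone.1 hcone.2
    rw [hlam2] at hb
    have e : Mhat - M = (Mhat - M₀) - T := by rw [hM]; abel
    have h1 : frobeniusNorm (Mhat - M) ^ 2 ≤
        2 * frobeniusNorm (Mhat - M₀) ^ 2 + 2 * frobeniusNorm T ^ 2 := by
      rw [e]
      have := frobeniusNorm_add_sq_add_sub_sq (Mhat - M₀) T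
      linarith [sq_nonneg (frobeniusNorm (Mhat - M₀ + T))]
    linarith
  -- A small `T` joins the noise: `S = 0` and `w = 𝒜(T) + z`.
  by_cases hc : opNorm T ≤ √n * σ ∧ frobeniusNorm T ^ 2 ≤ m * σ ^ 2 / 5
  · refine ⟨T, T, hc.1, hc.2, fun A z hgood => main A z 0 (measurementMap A T + z) ?_ ?_ ?_ ?_⟩
    · rw [hR, hnmax]; exact hgood.1
    · rw [add_zero, hM, measurementMap_add, add_assoc]
    · rw [hlam, hnmax]; exact hgood.2.2
    · have h1 : nuclearNorm (0 : Matrix (Fin n₁) (Fin n₂) ℝ) = 0 := by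
        simp [nuclearNorm, singularValue]
      have h2 : frobeniusNorm (0 : Matrix (Fin n₁) (Fin n₂) ℝ) = 0 := by simp [frobeniusNorm]
      rw [h1, h2]
      simp
      linarith
  -- A large `T` is replaced by its preimage `S`. The noise is `z` alone, so the noise estimate is
  -- invoked at the zero matrix.
  · refine ⟨T, 0, ?_, ?_, fun A z hgood => ?_⟩
    · have : opNorm (0 : Matrix (Fin n₁) (Fin n₂) ℝ) = 0 := by simp [opNorm]
      rw [this]; positivity
    · have : frobeniusNorm (0 : Matrix (Fin n₁) (Fin n₂) ℝ) = 0 := by simp [frobeniusNorm]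
      rw [this]; simp; positivity
    · obtain ⟨hRI, ⟨S, hS, hSF, hSN⟩, hw⟩ := hgood
      rw [← hnmax] at hRI hSN hw
      rw [← hR] at hRI
      refine main A z S (measurementMap A 0 + z) hRI ?_ hw ?_
      · have h0 : measurementMap A (0 : Matrix (Fin n₁) (Fin n₂) ℝ) = 0 := by
          ext i; simp [measurementMap_apply]
        rw [h0, zero_add, measurementMap_add, hS, ← measurementMap_add, ← hM]
      · set τ := frobeniusNorm T
        have hτ0 : 0 ≤ τ := frobeniusNorm_nonneg T
        -- Whichever condition fails, `mσ²` is controlled by the error: either `‖T‖_F²` exceeds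
        -- `mσ²/5`, or `I` is full and `m ≲ r₀ n`.
        have hmσ : m * (σ : ℝ) ^ 2 ≤ 5 * τ ^ 2 + 21233664 * (I.card * (n * σ ^ 2)) := by
          by_cases hcF : τ ^ 2 ≤ m * σ ^ 2 / 5
          · have hIr : I.card = r₀ := hcase.resolve_right fun h => hc ⟨h, hcF⟩
            have : m * (σ : ℝ) ^ 2 ≤ 21233664 * (r₀ * n) * σ ^ 2 := by gcongr
            rw [hIr]
            have := sq_nonneg τ
            linarith
          · push Not at hcF
            linarith
        have hsq : √(m : ℝ) ^ 2 = m := Real.sq_sqrt hm'.le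
        have k1 : lam * nuclearNorm S ≤ 128 * (m * σ ^ 2 + τ ^ 2) := by
          calc lam * nuclearNorm S ≤ lam * (16 * √(m / n) * τ) := by gcongr
            _ = 256 * (√m * σ * τ) := by
              rw [hlam, Real.sqrt_div hm'.le]; field_simp; ring
            _ ≤ _ := by nlinarith [sq_nonneg (√(m : ℝ) * σ - τ)]
        have k2 : nuclearNorm S ^ 2 / R ≤ 131072 * τ ^ 2 := by
          have : nuclearNorm S ^ 2 ≤ (16 * √(m / n) * τ) ^ 2 := by
            have := nuclearNorm_nonneg S
            gcongr
          rw [mul_pow, mul_pow, Real.sq_sqrt (by positivity)] at this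
          have hmn : (m : ℝ) / n ≤ 512 * R := by rw [div_le_iff₀ hn']; linarith
          rw [div_le_iff₀ hRpos]
          calc nuclearNorm S ^ 2 ≤ 16 ^ 2 * (m / n) * τ ^ 2 := this
            _ ≤ 16 ^ 2 * (512 * R) * τ ^ 2 := by gcongr
            _ = _ := by ring
        have k3 : frobeniusNorm S ^ 2 ≤ τ ^ 2 := by
          have := frobeniusNorm_nonneg S
          gcongr
        linarith

theorem instanceError_nonneg (M : Matrix (Fin n₁) (Fin n₂) ℝ) (σ : ℝ≥0) (r : ℕ) :
    0 ≤ instanceError M σ r := by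
  unfold instanceError
  exact add_nonneg (Finset.sum_nonneg fun i _ => le_min (sq_nonneg _) (by positivity))
    (Finset.sum_nonneg fun i _ => sq_nonneg _)

end Main

end MatrixRecovery

theorem mainTheorem3 :
    ∃ c₀ c₁ C D d : ℝ, 0 < c₀ ∧ 0 < c₁ ∧ 0 < C ∧ 0 < D ∧ 0 < d ∧
      ∀ (n₁ n₂ n m r : ℕ) (M : Matrix (Fin n₁) (Fin n₂) ℝ) (σ : ℝ≥0)
        (Ω : Type*) [MeasurableSpace Ω] (P : Measure Ω) [IsProbabilityMeasure P]
        (A : Ω → Fin m → Matrix (Fin n₁) (Fin n₂) ℝ) (z : Ω → Fin m → ℝ),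
        n = max n₁ n₂ →
        MatrixRecovery.IsGaussianEnsemble P A →
        MatrixRecovery.IsGaussianNoise P σ z →
        IndepFun (fun (ω : Ω) (p : Fin m × Fin n₁ × Fin n₂) => A ω p.1 p.2.1 p.2.2) z P →
        (n : ℝ) ≤ c₁ * m →
        (m : ℝ) ≤ c₀ * (n : ℝ) ^ 2 / Real.log ((m : ℝ) / n) →
        (r : ℝ) ≤ c₁ * m / n →
        P {ω | ¬ ∀ Mhat : Matrix (Fin n₁) (Fin n₂) ℝ,
            MatrixRecovery.IsDantzigSolution (A ω) (MatrixRecovery.measurementMap (A ω) M + z ω)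
              (16 * √(n : ℝ) * σ) Mhat →
            MatrixRecovery.frobeniusNorm (Mhat - M) ^ 2 ≤
              C * MatrixRecovery.instanceError M σ r}
          < ENNReal.ofReal (D * Real.exp (-d * n)) ∧
        (0 < σ →
          P {ω | ¬ ∀ Mhat : Matrix (Fin n₁) (Fin n₂) ℝ,
              MatrixRecovery.IsLassoSolution (A ω) (MatrixRecovery.measurementMap (A ω) M + z ω)
                (32 * √(n : ℝ) * σ) Mhat →
              MatrixRecovery.frobeniusNorm (Mhat - M) ^ 2 ≤
                C * MatrixRecovery.instanceError M σ r}
            < ENNReal.ofReal (D * Real.exp (-d * n))) := by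
  open MatrixRecovery in
  -- `D = 11` exceeds the `10` of the failure bound, so that the inequality is strict.
  refine ⟨1, 1 / 5308416, 10 ^ 17, 11, 1, by norm_num, by norm_num, by norm_num, by norm_num,
    by norm_num, ?_⟩
  intro n₁ n₂ n m r M σ Ω _ P _ A z hnmax hA hz hAz hnm _ hr
  -- For `n = 0` all matrices are empty, and the failure event is too.
  rcases Nat.eq_zero_or_pos n with rfl | hn
  · have h₁ : n₁ = 0 := by omega
    subst h₁
    have h : ∀ X : Matrix (Fin 0) (Fin n₂) ℝ,
        frobeniusNorm X ^ 2 ≤ 10 ^ 17 * instanceError M σ r := fun X => by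
      have := instanceError_nonneg M σ r
      simp only [frobeniusNorm]
      simp
      exact this
    have hpos : 0 < ENNReal.ofReal (11 * Real.exp (-1 * (0 : ℕ))) := by
      rw [ENNReal.ofReal_pos]; positivity
    simp only [h, implies_true, not_true_eq_false, Set.ofPred_false, measure_empty]
    exact ⟨hpos, fun _ => hpos⟩
  have hn' : (0 : ℝ) < n := by exact_mod_cast hn
  have hm : 5308416 * n ≤ m := by
    have : (5308416 : ℝ) * n ≤ m := by linarith
    exact_mod_cast this
  have hrm : r * (5308416 * n) ≤ m := by
    rw [le_div_iff₀ hn'] at hr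
    have : (r : ℝ) * (5308416 * n) ≤ m := by linarith
    exact_mod_cast this
  obtain ⟨T, T', hT, hTF, hmain⟩ := error_bound_of_isGoodRealization M σ hnmax hn hm hrm
  have hprob := prob_not_isGoodRealization_le hA hz hAz hnmax hn (by omega) T hT hTF
  have hlt : P {ω | ¬ IsGoodRealization (A ω) (z ω) σ T T'} <
      ENNReal.ofReal (11 * Real.exp (-1 * n)) := by
    rw [← ofReal_measureReal (measure_ne_top _ _), ENNReal.ofReal_lt_ofReal_iff (by positivity)]
    refine hprob.trans_lt ?_
    rw [neg_one_mul]
    have := Real.exp_pos (-(n : ℝ))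
    linarith
  have hbound : ∀ B : Matrix (Fin n₁) (Fin n₂) ℝ → Ω → Prop,
      (∀ ω, IsGoodRealization (A ω) (z ω) σ T T' → ∀ Mhat, B Mhat ω →
        frobeniusNorm (Mhat - M) ^ 2 ≤ 10 ^ 17 * instanceError M σ r) →
      P {ω | ¬ ∀ Mhat : Matrix (Fin n₁) (Fin n₂) ℝ, B Mhat ω →
        frobeniusNorm (Mhat - M) ^ 2 ≤ 10 ^ 17 * instanceError M σ r} <
        ENNReal.ofReal (11 * Real.exp (-1 * n)) := fun B hB =>
    (measure_mono (Set.ofPred_subset_ofPred.2 fun ω hω hgood => hω (hB ω hgood))).trans_lt hlt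
  exact ⟨hbound _ fun ω hgood Mhat h => hmain (A ω) (z ω) hgood Mhat (Or.inl h),
    fun hσ => hbound _ fun ω hgood Mhat h => hmain (A ω) (z ω) hgood Mhat (Or.inr ⟨hσ, h⟩)⟩
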